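/- Let $G$ be a connected $3$-regular loopless multigraph on $n \ge 8$ vertices having at most one $2$-cycle, where a $2$-cycle $uvu$ consists of two distinct edges joining $u$ and $v$ (parallel edges are counted separately in vertex degrees). A labeling of $G$ names its vertices $v_1,\dots,v_n$, bijectively. (i) Suppose $G$ has no multiple edges and is not the cube $Q_3$. Then $G$ has a labeling such that $v_1v_a, v_1v_b, v_1v_c \in E(G)$ for some distinct odd integers $a,b,c$ different from $1$, and $|i-j| \notin \{1,n-1\}$ whenever $v_iv_j \in E(G)$. (i$'$) If $G$ is the cube $Q_3$ (so $n=8$), then it has no labeling as in (i), but it has a labeling for which $$E(G)=\{v_1v_3, v_1v_4, v_1v_7, v_2v_4, v_2v_7, v_2v_8, v_3v_5, v_3v_6, v_4v_6, v_5v_7, v_5v_8, v_6v_8\}.$$ (ii) Suppose $uvu$ is a $2$-cycle of $G$. Then $G$ has a labeling such that $u=v_1$, $v=v_a$ and $v_1v_b\in E(G)$ for some distinct odd integers $a,b$ different from $1$, and $|i-j| \notin \{1,n-1\}$ whenever $v_iv_j \in E(G)$. (iii) Every labeling of $G$ with the properties in (i), (i$'$) or (ii) yields a $4$-angulation of $K_n-G$: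 whenever $v_1,\dots,v_n$ are placed in the plane as points in convex position, in this clockwise cyclic order, there is a graph $T$ on $v_1,\dots,v_n$, none of whose edges joins two vertices adjacent in $G$, whose straight-line drawing is plane and such that every face of this drawing interior to the convex hull of the points (that is, every connected component of the interior of the hull minus the drawing) is bounded by a $4$-cycle of $T$. -/

import Mathlib

open Graph

namespace CubicLabeling

variable {α β : Type*}

/-! ### Cubic multigraphs -/

/-- Every vertex lies on exactly three edges. (Used for loopless multigraphs, where this is
`3`-regularity; parallel edges are counted separately.) -/
def IsThreeRegular (G : Graph α β) : Prop :=
  ∀ x ∈ V(G), (G.incidenceSet x).ncard = 3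

/-- `u v u` is a `2`-cycle: two different edges join `u` and `v`. -/
def IsTwoCycle (G : Graph α β) (u v : α) : Prop :=
  ∃ e f : β, e ≠ f ∧ G.IsLink e u v ∧ G.IsLink f u v

def AtMostOneTwoCycle (G : Graph α β) : Prop :=
  ∀ u v u' v' : α, IsTwoCycle G u v → IsTwoCycle G u' v' → s(u, v) = s(u', v')

/-- The graph of the three-dimensional cube. -/
def cube : SimpleGraph (Fin 3 → Bool) where
  Adj x y := hammingDist x y = 1
  symm := ⟨fun x y h => by rw [hammingDist_comm]; exact h⟩
  loopless := ⟨fun x h => by simp at h⟩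

def IsCube (G : Graph α β) : Prop :=
  G.Simple ∧ Nonempty (G.toSimpleGraph ≃g cube)

/-! ### Labelings

A labeling of `V(G)` as `v_1, …, v_n` is a bijection `ℓ : V(G) ≃ Set.Icc 1 n`; the vertex `x` is
`v_i` when `ℓ x = i`. -/

/-- `|i - j| ∉ {1, n - 1}` whenever `v_i v_j` is an edge. -/
def NoConsecutive (G : Graph α β) {n : ℕ} (ℓ : V(G) ≃ Set.Icc 1 n) : Prop :=
  ∀ x y : V(G), G.Adj x y →
    |((ℓ x : ℕ) : ℤ) - ((ℓ y : ℕ) : ℤ)| ∉ ({1, (n : ℤ) - 1} : Set ℤ)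

/-- `v_1` is adjacent to `v_a, v_b, v_c` with `a, b, c` distinct odd integers different from `1`,
and no edge joins cyclically consecutive labels. -/
def IsOddLabeling (G : Graph α β) {n : ℕ} (ℓ : V(G) ≃ Set.Icc 1 n) : Prop :=
  (∃ r x y z : V(G), (ℓ r : ℕ) = 1 ∧ G.Adj r x ∧ G.Adj r y ∧ G.Adj r z ∧
    Odd (ℓ x : ℕ) ∧ Odd (ℓ y : ℕ) ∧ Odd (ℓ z : ℕ) ∧
    (ℓ x : ℕ) ≠ 1 ∧ (ℓ y : ℕ) ≠ 1 ∧ (ℓ z : ℕ) ≠ 1 ∧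
    (ℓ x : ℕ) ≠ (ℓ y : ℕ) ∧ (ℓ x : ℕ) ≠ (ℓ z : ℕ) ∧ (ℓ y : ℕ) ≠ (ℓ z : ℕ)) ∧
  NoConsecutive G ℓ

/-- `u = v_1`, `v = v_a`, and `v_1 v_b` is an edge, with `a, b` distinct odd integers different
from `1`, and no edge joins cyclically consecutive labels. -/
def IsTwoCycleLabeling (G : Graph α β) {n : ℕ} (ℓ : V(G) ≃ Set.Icc 1 n) (u v : V(G)) : Prop :=
  (ℓ u : ℕ) = 1 ∧
  (∃ w : V(G), G.Adj u w ∧ Odd (ℓ v : ℕ) ∧ Odd (ℓ w : ℕ) ∧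
    (ℓ v : ℕ) ≠ 1 ∧ (ℓ w : ℕ) ≠ 1 ∧ (ℓ v : ℕ) ≠ (ℓ w : ℕ)) ∧
  NoConsecutive G ℓ

/-- The edges of the labeled cube, as pairs of labels. -/
def labeledCubeEdges : Set (Sym2 ℕ) :=
  {s(1, 3), s(1, 4), s(1, 7), s(2, 4), s(2, 7), s(2, 8),
   s(3, 5), s(3, 6), s(4, 6), s(5, 7), s(5, 8), s(6, 8)}

def IsCubeLabeling (G : Graph α β) {n : ℕ} (ℓ : V(G) ≃ Set.Icc 1 n) : Prop :=
  ∀ x y : V(G), G.Adj x y ↔ s((ℓ x : ℕ), (ℓ y : ℕ)) ∈ labeledCubeEdges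

/-! ### Geometric graphs and `g`-angulations -/

abbrev Plane := EuclideanSpace ℝ (Fin 2)

variable {W : Type*}

/-- The point set of the straight-line drawing of `T` with vertex `x` placed at `q x`. -/
def drawing (q : W → Plane) (T : SimpleGraph W) : Set Plane :=
  Set.range q ∪ {z | ∃ x y : W, T.Adj x y ∧ z ∈ segment ℝ (q x) (q y)}

/-- The straight-line drawing is plane: different vertices are different points, an edge contains
no vertex except its ends, and two different edges meet at most in common ends. -/
structure IsPlaneDrawing (q : W → Plane) (T : SimpleGraph W) : Prop where
  injective : Function.Injective q
  vertex_edge : ∀ x y z : W, T.Adj x y → q z ∈ segment ℝ (q x) (q y) → z = x ∨ z = y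
  edge_edge : ∀ x y x' y' : W, T.Adj x y → T.Adj x' y' → s(x, y) ≠ s(x', y') →
    segment ℝ (q x) (q y) ∩ segment ℝ (q x') (q y') ⊆ q '' ({x, y} ∩ {x', y'})

/-- The faces of the drawing interior to the convex hull of the vertices: the connected components
into which the drawing cuts the interior of the hull. -/
def IsInteriorFace (q : W → Plane) (T : SimpleGraph W) (C : Set Plane) : Prop :=
  ∃ z ∈ interior (convexHull ℝ (Set.range q)) \ drawing q T,
    C = connectedComponentIn (interior (convexHull ℝ (Set.range q)) \ drawing q T) z

/-- `T`, drawn with vertex `x` at `q x`, is a `g`-angulation of the point set: a plane graph each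
of whose faces interior to the convex hull is a `g`-cycle. In particular each side of the hull is
covered by edges. -/
structure IsAngulation (g : ℕ) (q : W → Plane) (T : SimpleGraph W) : Prop where
  plane : IsPlaneDrawing q T
  face : ∀ C : Set Plane, IsInteriorFace q T C →
    ∃ (x : W) (c : T.Walk x x), c.IsCycle ∧ c.length = g ∧
      frontier C = {z | ∃ a b : W, s(a, b) ∈ c.edges ∧ z ∈ segment ℝ (q a) (q b)}

/-- The points `q x` are in convex position, and `v_1, …, v_n` is their clockwise cyclic order:
each three of them, in the order of their labels, make a right turn. -/
def IsClockwiseConvex {n : ℕ} (ℓ : W ≃ Set.Icc 1 n) (q : W → Plane) : Prop :=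
  ∀ x y z : W, (ℓ x : ℕ) < (ℓ y : ℕ) → (ℓ y : ℕ) < (ℓ z : ℕ) →
    (q y 0 - q x 0) * (q z 1 - q x 1) - (q y 1 - q x 1) * (q z 0 - q x 0) < 0

/-- However `v_1, …, v_n` are placed in convex position in clockwise order, `K_n - G` (the
complement of `G` on its vertex set) contains a `4`-angulation of the placed points. -/
def YieldsFourAngulation (G : Graph α β) {n : ℕ} (ℓ : V(G) ≃ Set.Icc 1 n) : Prop :=
  ∀ q : V(G) → Plane, IsClockwiseConvex ℓ q →
    ∃ T : SimpleGraph V(G), T ≤ G.toSimpleGraphᶜ ∧ IsAngulation 4 q T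

end CubicLabeling

/-! Write `n = 2k`; `n` is even by the handshake lemma. It is enough to find a `k`-set `A`
containing `u` and all its neighbours, and a Hamiltonian cycle of the complement of `G` that
alternates between `A` and its complement. Numbering the vertices along this cycle from `u` gives
`A` the odd labels and separates adjacent vertices cyclically.

Such a cycle is sought by a bipartite closure argument in the style of Bondy and Chvátal
(`exists_tour_of_deleteEdges`). If none exists, a minimal set `F` of edges across the cut that
cannot be avoided has `deg_F a + deg_F b ≥ k` on each of its edges (`exists_obstruction`). When `A`
induces no isolated vertex, `deg_F` is at most `2` on `A` and at most `3` off `A`, so `k ≥ 6` is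
immediate. For `k = 5`, and for `k = 4` with a `2`-cycle, one further vertex `a` of `A` is chosen
with care. In the remaining case `k = 4` without a `2`-cycle, `A` is a closed neighbourhood, `u` is
chosen away from vertices with equal neighbourhoods, and `F` must be a `6`-cycle, which forces the
cube.

The cube has no odd labeling, because each of the pairs `v₂v₄`, `v₄v₆`, `v₆v₈` would have to contain
the antipode of `v₁`.

For the angulation, join `v₁` to all even labels. The sides of the hull avoid `G` since consecutive
labels are not adjacent, and the diagonals avoid it since the neighbours of `v₁` are odd. The
labeled cube uses the diagonals `16` and `25` instead. `isAngulation_four` reduces the topology of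
faces to signs of orientations: the faces are intersections of four open half-planes. -/

namespace CubicLabeling

/-! ### Alternating Hamiltonian cycles avoiding a graph, and the closure argument. -/

section Tours

variable {V : Type*}

/-- The vertices `c 0, …, c (n - 1)`, in this cyclic order, lie alternately inside and outside `A`,
and no two cyclically consecutive ones are adjacent in `F`. -/
structure IsAvoidingTour (F : SimpleGraph V) (A : Set V) (n : ℕ) (c : ℕ → V) : Prop where
  injOn : ∀ i < n, ∀ j < n, c i = c j → i = j
  mem_iff : ∀ j < n, c j ∈ A ↔ Even j
  not_adj : ∀ j, j + 1 < n → ¬ F.Adj (c j) (c (j + 1))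
  not_adj_wrap : ¬ F.Adj (c (n - 1)) (c 0)

/-- An even shift preserves the parity of positions even across the wrap, since `n` is even. -/
lemma IsAvoidingTour.rotate {F : SimpleGraph V} {A : Set V} {n : ℕ} {c : ℕ → V}
    (h : IsAvoidingTour F A n c) (hn : Even n) {s : ℕ} (hs : Even s) (hsn : s < n) :
    IsAvoidingTour F A n (fun j => c (if j + s < n then j + s else j + s - n)) where
  injOn i hi j hj hij := by
    have := h.injOn _ (by split_ifs <;> omega) _ (by split_ifs <;> omega) hij
    split_ifs at this <;> omega
  mem_iff j hj := by
    rw [h.mem_iff _ (by split_ifs <;> omega)]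
    split_ifs <;> grind
  not_adj j hj := by
    rcases lt_trichotomy (j + 1 + s) n with hlt | heq | hgt
    · rw [if_pos (by omega), if_pos hlt, show j + 1 + s = j + s + 1 by ring]
      exact h.not_adj _ (by omega)
    · rw [if_pos (by omega), if_neg (by omega), show j + s = n - 1 by omega,
        show j + 1 + s - n = 0 by omega]
      exact h.not_adj_wrap
    · rw [if_neg (by omega), if_neg (by omega), show j + 1 + s - n = j + s - n + 1 by omega]
      exact h.not_adj _ (by omega)
  not_adj_wrap := by
    rcases Nat.eq_zero_or_pos s with rfl | hs0
    · simpa [show n - 1 < n by omega, show 0 < n by omega] using h.not_adj_wrap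
    · rw [if_neg (by omega), if_pos (by omega)]
      have := h.not_adj (s - 1) (by omega)
      rwa [show s - 1 + 1 = 0 + s by omega, show s - 1 = n - 1 + s - n by omega] at this

lemma IsAvoidingTour.reflect {F : SimpleGraph V} {A : Set V} {n : ℕ} {c : ℕ → V}
    (h : IsAvoidingTour F A n c) (hn : Even n) {s : ℕ} (hs : Even s) (hsn : s < n) :
    IsAvoidingTour F A n (fun j => c (if j ≤ s then s - j else s + n - j)) where
  injOn i hi j hj hij := by
    have := h.injOn _ (by split_ifs <;> omega) _ (by split_ifs <;> omega) hij
    split_ifs at this <;> omega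
  mem_iff j hj := by
    rw [h.mem_iff _ (by split_ifs <;> omega)]
    split_ifs <;> grind
  not_adj j hj := by
    rw [F.adj_comm]
    rcases lt_trichotomy j s with hlt | heq | hgt
    · rw [if_pos (by omega), if_pos (by omega), show s - j = s - (j + 1) + 1 by omega]
      exact h.not_adj _ (by omega)
    · rw [if_neg (by omega), if_pos (by omega), show s + n - (j + 1) = n - 1 by omega,
        show s - j = 0 by omega]
      exact h.not_adj_wrap
    · rw [if_neg (by omega), if_neg (by omega), show s + n - j = s + n - (j + 1) + 1 by omega]
      exact h.not_adj _ (by omega)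
  not_adj_wrap := by
    rw [F.adj_comm, if_pos (Nat.zero_le _), Nat.sub_zero]
    by_cases hs1 : n - 1 ≤ s
    · rw [if_pos hs1]
      rw [show s = n - 1 by omega, Nat.sub_self]
      exact h.not_adj_wrap
    · rw [if_neg hs1, show s + n - (n - 1) = s + 1 by omega]
      exact h.not_adj _ (by omega)

/-- Reversing an initial segment of a path turns it into a tour, if the two new pairs are fine. -/
lemma isAvoidingTour_reverse_prefix {F : SimpleGraph V} {A : Set V} {n : ℕ} {c : ℕ → V}
    (hinj : ∀ i < n, ∀ j < n, c i = c j → i = j) (hmem : ∀ j < n, c j ∈ A ↔ Even j)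
    (hadj : ∀ j, j + 1 < n → ¬ F.Adj (c j) (c (j + 1))) {s : ℕ} (hs : Even s) (hsn : s + 1 < n)
    (h₁ : ¬ F.Adj (c 0) (c (s + 1))) (h₂ : ¬ F.Adj (c (n - 1)) (c s)) :
    IsAvoidingTour F A n (fun j => c (if j ≤ s then s - j else j)) where
  injOn i hi j hj hij := by
    have := hinj _ (by split_ifs <;> omega) _ (by split_ifs <;> omega) hij
    split_ifs at this <;> omega
  mem_iff j hj := by
    rw [hmem _ (by split_ifs <;> omega)]
    split_ifs <;> grind
  not_adj j hj := by
    rcases lt_trichotomy j s with hlt | rfl | hgt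
    · rw [F.adj_comm, if_pos (by omega), if_pos (by omega), show s - j = s - (j + 1) + 1 by omega]
      exact hadj _ (by omega)
    · rw [if_pos le_rfl, if_neg (by omega), Nat.sub_self]
      exact h₁
    · rw [if_neg (by omega), if_neg (by omega)]
      exact hadj _ hj
  not_adj_wrap := by
    rw [if_neg (by omega), if_pos (Nat.zero_le _)]
    exact h₂

/-- A tour that avoids all edges of `F` but possibly `ab` can be changed into one that avoids `ab`
as well, if `a` and `b` have few neighbours. -/
lemma exists_tour_of_deleteEdges [Finite V] {F : SimpleGraph V} {A : Set V} {k : ℕ} {a b : V}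
    (hab : F.Adj a b) (ha : a ∈ A)
    (hdeg : (F.neighborSet a).ncard + (F.neighborSet b).ncard < k)
    (h : ∃ c, IsAvoidingTour (F.deleteEdges {s(a, b)}) A (2 * k) c) :
    ∃ c, IsAvoidingTour F A (2 * k) c := by
  obtain ⟨c, hc⟩ := h
  by_contra hno
  have hn : Even (2 * k) := even_two_mul k
  have hda : 0 < (F.neighborSet a).ncard :=
    (Set.ncard_pos (Set.toFinite _)).2 ⟨b, hab⟩
  have hdb : 0 < (F.neighborSet b).ncard :=
    (Set.ncard_pos (Set.toFinite _)).2 ⟨a, hab.symm⟩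
  -- The only possible defect is the pair `ab`. A rotation or a reflection moves it to the wrap, and
  -- parity then puts `a` at position `0` and `b` at the end.
  have key : ∃ c, IsAvoidingTour (F.deleteEdges {s(a, b)}) A (2 * k) c ∧ c 0 = a ∧
      c (2 * k - 1) = b := by
    have hmain : ∀ c, IsAvoidingTour (F.deleteEdges {s(a, b)}) A (2 * k) c →
        F.Adj (c (2 * k - 1)) (c 0) → c 0 = a ∧ c (2 * k - 1) = b := by
      intro c hc hadj
      have hw := hc.not_adj_wrap
      simp only [SimpleGraph.deleteEdges_adj, Set.mem_singleton_iff, not_and, not_not] at hw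
      rcases Sym2.eq_iff.1 (hw hadj) with ⟨h1, h2⟩ | ⟨h1, h2⟩
      · have := (hc.mem_iff (2 * k - 1) (by omega)).1 (h1 ▸ ha)
        exact absurd this (by grind)
      · exact ⟨h2, h1⟩
    by_cases hw : F.Adj (c (2 * k - 1)) (c 0)
    · exact ⟨c, hc, hmain c hc hw⟩
    · have : ∃ j, j + 1 < 2 * k ∧ F.Adj (c j) (c (j + 1)) := by
        by_contra! hall
        exact hno ⟨c, hc.injOn, hc.mem_iff, hall, hw⟩
      obtain ⟨j, hj, hadj⟩ := this
      rcases Nat.even_or_odd j with hje | hjo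
      · have hc' := hc.reflect hn hje (by omega)
        refine ⟨_, hc', hmain _ hc' ?_⟩
        rw [if_pos (Nat.zero_le _), if_neg (by omega),
          show j + 2 * k - (2 * k - 1) = j + 1 by omega]
        exact hadj.symm
      · have hc' := hc.rotate hn (s := j + 1) (by grind) (by omega)
        refine ⟨_, hc', hmain _ hc' ?_⟩
        rw [if_neg (by omega), if_pos (by omega),
          show 2 * k - 1 + (j + 1) - 2 * k = j by omega, Nat.zero_add]
        exact hadj
  obtain ⟨c, hc, h0, h1⟩ := key
  have hpath : ∀ j, j + 1 < 2 * k → ¬ F.Adj (c j) (c (j + 1)) := by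
    intro j hj hadj
    have hw := hc.not_adj j hj
    simp only [SimpleGraph.deleteEdges_adj, Set.mem_singleton_iff, not_and, not_not] at hw
    rw [← h0, ← h1] at hw
    rcases Sym2.eq_iff.1 (hw hadj) with ⟨h2, h3⟩ | ⟨h2, h3⟩
    · have e1 := hc.injOn _ (by omega) _ (by omega) h2
      have e2 := hc.injOn _ (by omega) _ (by omega) h3
      omega
    · have e2 := hc.injOn _ (by omega) _ (by omega) h3
      omega
  -- Each neighbour of `a` or `b` spoils at most one index `i`, so fewer than `k` indices are
  -- spoiled. For a good `i`, reversing `c 0, …, c (2 * i)` replaces the wrap `ba` by two harmless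
  -- pairs.
  have hgood : ∃ i < k, ¬ F.Adj a (c (2 * i + 1)) ∧ ¬ F.Adj b (c (2 * i)) := by
    by_contra! hbad
    have hcov : (Set.Iio k) ⊆ {i | i < k ∧ F.Adj a (c (2 * i + 1))} ∪
        {i | i < k ∧ F.Adj b (c (2 * i))} := by
      intro i hi
      by_cases hi' : F.Adj a (c (2 * i + 1))
      · exact Or.inl ⟨hi, hi'⟩
      · exact Or.inr ⟨hi, hbad i hi hi'⟩
    have hfin1 : ({i | i < k ∧ F.Adj a (c (2 * i + 1))} : Set ℕ).Finite :=
      (Set.finite_Iio k).subset fun i hi => hi.1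
    have hfin2 : ({i | i < k ∧ F.Adj b (c (2 * i))} : Set ℕ).Finite :=
      (Set.finite_Iio k).subset fun i hi => hi.1
    have hle := (Set.ncard_le_ncard hcov (hfin1.union hfin2)).trans (Set.ncard_union_le _ _)
    have hle1 : ({i | i < k ∧ F.Adj a (c (2 * i + 1))} : Set ℕ).ncard ≤
        (F.neighborSet a).ncard := by
      refine Set.ncard_le_ncard_of_injOn (fun i => c (2 * i + 1)) (fun i hi => hi.2) ?_
      intro i hi j hj hij
      have hi1 := hi.1
      have hj1 := hj.1
      have := hc.injOn _ (by omega) _ (by omega) hij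
      omega
    have hle2 : ({i | i < k ∧ F.Adj b (c (2 * i))} : Set ℕ).ncard ≤
        (F.neighborSet b).ncard := by
      refine Set.ncard_le_ncard_of_injOn (fun i => c (2 * i)) (fun i hi => hi.2) ?_
      intro i hi j hj hij
      have hi1 := hi.1
      have hj1 := hj.1
      have := hc.injOn _ (by omega) _ (by omega) hij
      omega
    rw [← Finset.coe_Iio, Set.ncard_coe_finset, Nat.card_Iio] at hle
    omega
  obtain ⟨i, hi, hi1, hi2⟩ := hgood
  rw [← h0] at hi1
  rw [← h1] at hi2
  -- The last index is never good: there `c (2 * i + 1)` is `b`, a neighbour of `a`.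
  by_cases hlast : 2 * i + 1 = 2 * k - 1
  · rw [hlast, h0, h1] at hi1
    exact hi1 hab
  · exact hno ⟨_, isAvoidingTour_reverse_prefix hc.injOn hc.mem_iff hpath (even_two_mul i)
      (by omega) hi1 hi2⟩

lemma exists_tour_bot [Finite V] (A : Set V) {k : ℕ} (hk : 0 < k) (hA : A.ncard = k)
    (hV : Nat.card V = 2 * k) : ∃ c, IsAvoidingTour (⊥ : SimpleGraph V) A (2 * k) c := by
  have hB : Aᶜ.ncard = k := by
    have := Set.ncard_add_ncard_compl A
    omega
  rw [← Nat.card_coe_set_eq] at hA hB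
  let e₁ : Fin k ≃ A := (Finite.equivFinOfCardEq hA).symm
  let e₂ : Fin k ≃ (Aᶜ : Set V) := (Finite.equivFinOfCardEq hB).symm
  -- The reduction modulo `k` only makes the sequence total; it does nothing below `2 * k`.
  have hlt : ∀ j, j / 2 % k < k := fun j => Nat.mod_lt _ hk
  have hdiv : ∀ j < 2 * k, j / 2 % k = j / 2 := fun j hj => Nat.mod_eq_of_lt (by omega)
  refine ⟨fun j => if Even j then (e₁ ⟨j / 2 % k, hlt j⟩ : V) else (e₂ ⟨j / 2 % k, hlt j⟩ : V),
    ?_, ?_, by simp, by simp⟩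
  · intro i hi j hj hij
    beta_reduce at hij
    split_ifs at hij with h1 h2 h2
    · have := e₁.injective (Subtype.ext hij)
      simp only [Fin.mk.injEq, hdiv i hi, hdiv j hj] at this
      grind
    · exact absurd (hij ▸ (e₁ _).2) (e₂ ⟨j / 2 % k, hlt j⟩).2
    · exact absurd (hij ▸ (e₁ ⟨j / 2 % k, hlt j⟩).2) (e₂ ⟨i / 2 % k, hlt i⟩).2
    · have := e₂.injective (Subtype.ext hij)
      simp only [Fin.mk.injEq, hdiv i hi, hdiv j hj] at this
      grind
  · intro j hj
    split_ifs with h1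
    · exact iff_of_true (e₁ _).2 h1
    · exact iff_of_false (e₂ _).2 h1

/-- If the edges of `Γ` cannot be avoided, some nonempty set of edges between `A` and its
complement has large degree sums along its edges. -/
lemma exists_obstruction [Finite V] (Γ : SimpleGraph V) (A : Set V) {k : ℕ} (hk : 0 < k)
    (hA : A.ncard = k) (hV : Nat.card V = 2 * k)
    (hno : ¬ ∃ c, IsAvoidingTour Γ A (2 * k) c) :
    ∃ F : SimpleGraph V, F ≤ Γ ∧ (∃ a b, a ∈ A ∧ F.Adj a b) ∧
      (∀ a b, F.Adj a b → (a ∈ A ↔ b ∉ A)) ∧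
      ∀ a b, a ∈ A → F.Adj a b → k ≤ (F.neighborSet a).ncard + (F.neighborSet b).ncard := by
  have hk1 : Odd (2 * k - 1) := ⟨k - 1, by omega⟩
  -- An alternating tour never uses a pair inside `A` or inside its complement, so only edges across
  -- the cut matter.
  let Γ₀ : SimpleGraph V :=
    { Adj := fun x y => Γ.Adj x y ∧ (x ∈ A ↔ y ∉ A)
      symm := ⟨fun x y h => ⟨h.1.symm, by tauto⟩⟩
      loopless := ⟨fun x h => Γ.loopless.irrefl x h.1⟩ }
  have h₀ : ¬ ∃ c, IsAvoidingTour Γ₀ A (2 * k) c := by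
    rintro ⟨c, hc⟩
    refine hno ⟨c, hc.injOn, hc.mem_iff, fun j hj hadj => hc.not_adj j hj ⟨hadj, ?_⟩,
      fun hadj => hc.not_adj_wrap ⟨hadj, ?_⟩⟩
    · rw [hc.mem_iff _ (by omega), hc.mem_iff _ hj]
      grind
    · rw [hc.mem_iff _ (by omega), hc.mem_iff _ (by omega)]
      grind
  -- By minimality, deleting any edge of `F` makes a tour possible; a small degree sum along that
  -- edge would then repair the tour for `F` itself.
  obtain ⟨F, ⟨hFle, hFno⟩, hmin⟩ := wellFounded_lt.has_min
    {F : SimpleGraph V | F ≤ Γ₀ ∧ ¬ ∃ c, IsAvoidingTour F A (2 * k) c} ⟨Γ₀, le_rfl, h₀⟩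
  refine ⟨F, fun x y h => (hFle h).1, ?_, fun a b h => (hFle h).2, ?_⟩
  · by_contra! hF
    have : F = ⊥ := by
      ext x y
      refine iff_of_false (fun h => ?_) (by simp)
      by_cases hx : x ∈ A
      · exact hF x y hx h
      · have := (hFle h).2
        exact hF y x (by tauto) h.symm
    exact hFno (this ▸ exists_tour_bot A hk hA hV)
  · intro a b ha hab
    by_contra! hlt
    have hle : F.deleteEdges {s(a, b)} ≤ F := SimpleGraph.deleteEdges_le _
    refine hFno (exists_tour_of_deleteEdges hab ha hlt ?_)
    by_contra hno'
    refine hmin _ ⟨hle.trans hFle, hno'⟩ (lt_of_le_of_ne hle ?_)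
    intro heq
    rw [← heq] at hab
    simp at hab

end Tours

/-! ### Counting neighbours, and growing sets without isolated vertices. -/

section Neighborhoods

variable {V : Type*}

lemma ncard_triple {a b c : V} (hab : a ≠ b) (hac : a ≠ c) (hbc : b ≠ c) :
    ({a, b, c} : Set V).ncard = 3 := by
  rw [Set.ncard_insert_of_notMem (by simp [hab, hac]), Set.ncard_pair hbc]

lemma eq_or_eq_or_eq_of_ncard_le_three [Finite V] {s : Set V} (hs : s.ncard ≤ 3) {a b c q : V}
    (ha : a ∈ s) (hb : b ∈ s) (hc : c ∈ s) (hab : a ≠ b) (hac : a ≠ c) (hbc : b ≠ c)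
    (hq : q ∈ s) : q = a ∨ q = b ∨ q = c := by
  have hsub : ({a, b, c} : Set V) ⊆ s := by
    rintro x (rfl | rfl | rfl) <;> assumption
  have := Set.eq_of_subset_of_ncard_le hsub (by rwa [ncard_triple hab hac hbc])
    (Set.toFinite _)
  rw [← this] at hq
  exact hq

lemma exists_adj_mem_notMem {Γ : SimpleGraph V} (hΓ : Γ.Connected) {A : Set V} (hA : A.Nonempty)
    (hA' : A ≠ Set.univ) : ∃ a b, a ∈ A ∧ b ∉ A ∧ Γ.Adj a b := by
  obtain ⟨a, ha⟩ := hA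
  obtain ⟨b, hb⟩ := (Set.ne_univ_iff_exists_notMem A).1 hA'
  obtain ⟨p⟩ := hΓ.preconnected a b
  obtain ⟨d, -, h1, h2⟩ := p.exists_boundary_dart A ha hb
  exact ⟨d.fst, d.snd, h1, h2, d.adj⟩

/-- In a connected graph, a set without isolated vertices extends to such a set of any size. -/
lemma exists_superset_ncard_eq [Finite V] {Γ : SimpleGraph V} (hΓ : Γ.Connected) {k : ℕ}
    (hk : k ≤ Nat.card V) {A₀ : Set V} (hne : A₀.Nonempty)
    (h₀ : ∀ x ∈ A₀, ∃ y ∈ A₀, Γ.Adj x y) (hcard : A₀.ncard ≤ k) :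
    ∃ A : Set V, A₀ ⊆ A ∧ A.ncard = k ∧ ∀ x ∈ A, ∃ y ∈ A, Γ.Adj x y := by
  induction hm : k - A₀.ncard generalizing A₀ with
  | zero => exact ⟨A₀, subset_rfl, by omega, h₀⟩
  | succ m ih =>
    have hA' : A₀ ≠ Set.univ := by
      rintro rfl
      rw [Set.ncard_univ] at hm
      omega
    obtain ⟨a, b, ha, hb, hab⟩ := exists_adj_mem_notMem hΓ hne hA'
    have hc : (insert b A₀).ncard = A₀.ncard + 1 := Set.ncard_insert_of_notMem hb
    obtain ⟨A, hA, hAk, hAn⟩ := ih (A₀ := insert b A₀) ⟨b, Set.mem_insert _ _⟩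
      (by
        rintro x (rfl | hx)
        · exact ⟨a, Or.inr ha, hab.symm⟩
        · obtain ⟨y, hy, hxy⟩ := h₀ x hx
          exact ⟨y, Or.inr hy, hxy⟩) (by omega) (by omega)
    exact ⟨A, (Set.subset_insert _ _).trans hA, hAk, hAn⟩

/-- Neighbours on the same side of the cut reduce the degree across the cut. -/
lemma ncard_neighborSet_add_le [Finite V] {Γ F : SimpleGraph V} {A : Set V} (hF : F ≤ Γ)
    (hcut : ∀ a b, F.Adj a b → (a ∈ A ↔ b ∉ A)) {a : V} (ha : a ∈ A) {S : Set V} (hS : S ⊆ A)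
    (hadj : ∀ y ∈ S, Γ.Adj a y) :
    (F.neighborSet a).ncard + S.ncard ≤ (Γ.neighborSet a).ncard := by
  have hdisj : Disjoint (F.neighborSet a) S := by
    rw [Set.disjoint_left]
    exact fun y hy hyS => (hcut a y hy).1 ha (hS hyS)
  rw [← Set.ncard_union_eq hdisj]
  refine Set.ncard_le_ncard (Set.union_subset (fun y hy => hF hy) hadj)

lemma neighborSet_subset_of_cut {F : SimpleGraph V} {A : Set V}
    (hcut : ∀ a b, F.Adj a b → (a ∈ A ↔ b ∉ A)) {b : V} (hb : b ∉ A) : F.neighborSet b ⊆ A :=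
  fun a ha => (hcut a b ha.symm).2 hb

end Neighborhoods

/-! ### Tours for at least ten vertices, or in the presence of a `2`-cycle. -/

section LargeOrder

variable {V : Type*} [Finite V] {Γ : SimpleGraph V} {k : ℕ}

/-- A neighbour inside `A` leaves at most two edges across the cut at a vertex of `A`, so degree
sums in an obstruction are at most `2 + 3 < 6`. -/
lemma exists_tour_of_six_le (hdeg : ∀ x, (Γ.neighborSet x).ncard ≤ 3) (hk : 6 ≤ k)
    (hV : Nat.card V = 2 * k) {A : Set V} (hA : A.ncard = k)
    (hAn : ∀ x ∈ A, ∃ y ∈ A, Γ.Adj x y) : ∃ c, IsAvoidingTour Γ A (2 * k) c := by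
  by_contra hno
  obtain ⟨F, hF, ⟨a, b, ha, hab⟩, hcut, hsum⟩ := exists_obstruction Γ A (by omega) hA hV hno
  obtain ⟨y, hy, hay⟩ := hAn a ha
  have h1 := ncard_neighborSet_add_le hF hcut ha (S := {y}) (by simpa) (by simpa)
  rw [Set.ncard_singleton] at h1
  have h2 : (F.neighborSet b).ncard ≤ (Γ.neighborSet b).ncard :=
    Set.ncard_le_ncard fun y hy => hF hy
  have h3 := hsum a b ha hab
  have h4 := hdeg a
  have h5 := hdeg b
  omega

/-- The tour for a graph with exactly one `2`-cycle `uvu`, where `w` is the other neighbour of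
`u`. -/
lemma exists_tour_of_degree_two (hΓ : Γ.Connected) (hk : 4 ≤ k) (hV : Nat.card V = 2 * k)
    (hdeg : ∀ x, (Γ.neighborSet x).ncard ≤ 3) {u v w : V} (huv : Γ.Adj u v) (huw : Γ.Adj u w)
    (hvw : v ≠ w) (hu : (Γ.neighborSet u).ncard ≤ 2) (hv : (Γ.neighborSet v).ncard ≤ 2)
    (hw : (Γ.neighborSet w).ncard = 3) :
    ∃ A c, u ∈ A ∧ v ∈ A ∧ w ∈ A ∧ IsAvoidingTour Γ A (2 * k) c := by
  have hnu : ∀ q, Γ.Adj u q → q = v ∨ q = w := by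
    intro q hq
    by_contra! hne
    have : ({v, w, q} : Set V) ⊆ Γ.neighborSet u := by
      rintro x (rfl | rfl | rfl) <;> assumption
    have := Set.ncard_le_ncard this
    rw [ncard_triple hvw hne.1.symm hne.2.symm] at this
    omega
  have hne_uv := huv.ne
  have hne_uw := huw.ne
  -- The vertex `a` is a neighbour of `w`, chosen to be a common neighbour of `v` and `w` if there
  -- is one besides `u`. This matters only for `k = 4`.
  obtain ⟨a, haw, hau, hav, hmax⟩ : ∃ a, Γ.Adj w a ∧ a ≠ u ∧ a ≠ v ∧
      ∀ b, b ≠ u → b ≠ w → Γ.Adj v b → Γ.Adj w b → Γ.Adj v a := by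
    by_cases hex : ∃ b, b ≠ u ∧ b ≠ w ∧ Γ.Adj v b ∧ Γ.Adj w b
    · obtain ⟨b, hbu, hbw, hvb, hwb⟩ := hex
      exact ⟨b, hwb, hbu, hvb.ne', fun _ _ _ _ _ => hvb⟩
    · have : ∃ a ∈ Γ.neighborSet w, a ∉ ({u, v} : Set V) := by
        by_contra! hall
        have := Set.ncard_le_ncard (show Γ.neighborSet w ⊆ {u, v} from hall)
        have := Set.ncard_pair hne_uv
        omega
      obtain ⟨a, ha, hauv⟩ := this
      simp only [Set.mem_insert_iff, Set.mem_singleton_iff, not_or] at hauv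
      exact ⟨a, ha, hauv.1, hauv.2, fun b h1 h2 h3 h4 => absurd ⟨b, h1, h2, h3, h4⟩ hex⟩
  have hne_aw := haw.ne'
  have hcard₀ : ({a, u, v, w} : Set V).ncard = 4 := by
    rw [Set.ncard_insert_of_notMem (by simp [hau, hav, hne_aw]),
      ncard_triple hne_uv hne_uw hvw]
  obtain ⟨A, hA₀, hA, hAn⟩ := exists_superset_ncard_eq hΓ (k := k) (by omega)
    (A₀ := {a, u, v, w}) ⟨a, by simp⟩
    (by
      rintro x (rfl | rfl | rfl | rfl)
      · exact ⟨w, by simp, haw.symm⟩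
      · exact ⟨v, by simp, huv⟩
      · exact ⟨u, by simp, huv.symm⟩
      · exact ⟨u, by simp, huw.symm⟩) (by omega)
  have ha : a ∈ A := hA₀ (by simp)
  have hu' : u ∈ A := hA₀ (by simp)
  have hv' : v ∈ A := hA₀ (by simp)
  have hw' : w ∈ A := hA₀ (by simp)
  suffices ∃ c, IsAvoidingTour Γ A (2 * k) c by
    obtain ⟨c, hc⟩ := this
    exact ⟨A, c, hu', hv', hw', hc⟩
  by_cases hk6 : 6 ≤ k
  · exact exists_tour_of_six_le hdeg hk6 hV hA hAn
  by_contra hno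
  obtain ⟨F, hF, ⟨a₀, b₀, ha₀, hab₀⟩, hcut, hsum⟩ :=
    exists_obstruction Γ A (by omega) hA hV hno
  have hpair : ∀ p y z, p ∈ A → y ∈ A → z ∈ A → y ≠ z → Γ.Adj p y → Γ.Adj p z →
      (F.neighborSet p).ncard + 2 ≤ (Γ.neighborSet p).ncard := by
    intro p y z hp hy hz hyz hpy hpz
    rw [← Set.ncard_pair hyz]
    refine ncard_neighborSet_add_le hF hcut hp ?_ ?_
    · rintro x (rfl | rfl) <;> assumption
    · rintro x (rfl | rfl) <;> assumption
  have hsingle : ∀ p ∈ A, (F.neighborSet p).ncard + 1 ≤ (Γ.neighborSet p).ncard := by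
    intro p hp
    obtain ⟨y, hy, hpy⟩ := hAn p hp
    rw [← Set.ncard_singleton y]
    exact ncard_neighborSet_add_le hF hcut hp (by simpa) (by simpa)
  have hFu := hpair u v w hu' hv' hw' hvw huv huw
  have hFw := hpair w u a hw' hu' ha hau.symm huw.symm haw
  have hFv := hsingle v hv'
  have hb₀ : b₀ ∉ A := (hcut _ _ hab₀).1 ha₀
  have hpos : ∀ p, F.Adj b₀ p → 0 < (F.neighborSet p).ncard := fun p hp =>
    (Set.ncard_pos (Set.toFinite _)).2 ⟨b₀, hp.symm⟩
  have hFb : (F.neighborSet b₀).ncard ≤ 3 :=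
    (Set.ncard_le_ncard fun y hy => hF hy).trans (hdeg b₀)
  have hFsum : ∀ p, F.Adj b₀ p → k ≤ (F.neighborSet p).ncard + (F.neighborSet b₀).ncard :=
    fun p hp => hsum p b₀ ((hcut p b₀ hp.symm).2 hb₀) hp.symm
  have hFA := neighborSet_subset_of_cut hcut hb₀
  obtain hk5 | hk4 : k = 5 ∨ k = 4 := by omega
  · have hb3 : 3 ≤ (F.neighborSet b₀).ncard := by
      have h1 := hsum a₀ b₀ ha₀ hab₀
      have h2 := hsingle a₀ ha₀
      have h3 := hdeg a₀
      omega
    -- Every `F`-neighbour of `b₀` has `F`-degree at least `2`, while `u, v, w` have at most `0, 1,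
    -- 1`. Only two vertices of `A` remain for three neighbours.
    have hsub : F.neighborSet b₀ ⊆ A \ {u, v, w} := by
      intro p hp
      refine ⟨hFA hp, ?_⟩
      have h1 := hFsum p hp
      rintro (rfl | rfl | rfl) <;> omega
    have h1 := Set.ncard_le_ncard hsub
    rw [Set.ncard_sdiff (by rintro x (rfl | rfl | rfl) <;> assumption),
      ncard_triple hne_uv hne_uw hvw] at h1
    omega
  · have hAeq : ({a, u, v, w} : Set V) = A :=
      Set.eq_of_subset_of_ncard_le hA₀ (by omega) (Set.toFinite _)
    have hNb : ∀ p, F.Adj b₀ p → p = a ∨ p = v ∨ p = w := by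
      intro p hp
      have h1 : p ∈ A := hFA hp
      rw [← hAeq] at h1
      rcases h1 with rfl | rfl | rfl | rfl
      · simp
      · have := hpos _ hp
        omega
      · simp
      · simp
    -- If `v` and `a` are adjacent, `v` has no edge across the cut and `a`, `w` have at most one
    -- each, so degree sums are at most `1 + 2`.
    by_cases hva : Γ.Adj v a
    · have hFv2 := hpair v u a hv' hu' ha hau.symm huv.symm hva
      have hFa := hpair a v w ha hv' hw' hvw hva.symm haw.symm
      have hda := hdeg a
      have hsub : F.neighborSet b₀ ⊆ {a, w} := by
        intro p hp
        rcases hNb p hp with rfl | rfl | rfl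
        · simp
        · have := hpos _ hp
          omega
        · simp
      have h1 := Set.ncard_le_ncard hsub
      rw [Set.ncard_pair hne_aw] at h1
      have h2 := hFsum a₀ hab₀.symm
      rcases hNb a₀ hab₀.symm with rfl | rfl | rfl <;> omega
    -- Otherwise, by the choice of `a`, `b₀` is not adjacent to both `v` and `w`. Its `F`-neighbours
    -- then need `F`-degree at least `2`, which leaves only `a`.
    · have hb2 : (F.neighborSet b₀).ncard ≤ 2 := by
        have hnot : ¬ (F.Adj b₀ v ∧ F.Adj b₀ w) := by
          rintro ⟨h1, h2⟩
          exact hva (hmax b₀ (by rintro rfl; exact hb₀ hu') (by rintro rfl; exact hb₀ hw')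
            (hF h1).symm (hF h2).symm)
        by_cases h1 : F.Adj b₀ v
        · have hsub : F.neighborSet b₀ ⊆ {a, v} := by
            intro p hp
            rcases hNb p hp with rfl | rfl | rfl
            · simp
            · simp
            · exact absurd ⟨h1, hp⟩ hnot
          exact (Set.ncard_le_ncard hsub).trans (Set.ncard_pair hav).le
        · have hsub : F.neighborSet b₀ ⊆ {a, w} := by
            intro p hp
            rcases hNb p hp with rfl | rfl | rfl
            · simp
            · exact absurd hp h1
            · simp
          exact (Set.ncard_le_ncard hsub).trans (Set.ncard_pair hne_aw).le
      have hall : ∀ p, F.Adj b₀ p → p = a := by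
        intro p hp
        have h2 := hFsum p hp
        rcases hNb p hp with rfl | rfl | rfl
        · rfl
        · omega
        · omega
      have hsub : F.neighborSet b₀ ⊆ {a} := hall
      have h1 := Set.ncard_le_ncard hsub
      rw [Set.ncard_singleton] at h1
      have h2 := hFsum a₀ hab₀.symm
      have h3 := hsingle a₀ ha₀
      have h4 := hdeg a₀
      omega

/-- The tour for a simple cubic graph on at least ten vertices. -/
lemma exists_tour_of_five_le (hΓ : Γ.Connected) (hk : 5 ≤ k) (hV : Nat.card V = 2 * k)
    (hdeg : ∀ x, (Γ.neighborSet x).ncard = 3) (u : V) :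
    ∃ A c, u ∈ A ∧ Γ.neighborSet u ⊆ A ∧ IsAvoidingTour Γ A (2 * k) c := by
  have huN : u ∉ Γ.neighborSet u := Γ.loopless.irrefl u
  have hcardN : (insert u (Γ.neighborSet u)).ncard = 4 := by
    rw [Set.ncard_insert_of_notMem huN, hdeg]
  -- If some vertex outside the closed neighbourhood of `u` has two neighbours in `N(u)`, then `a`
  -- is such a vertex; otherwise any vertex at distance two serves.
  obtain ⟨a, ⟨x, hxu, hxa⟩, haN, hau, hmax⟩ : ∃ a, (∃ x, Γ.Adj u x ∧ Γ.Adj x a) ∧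
      ¬ Γ.Adj u a ∧ a ≠ u ∧
      ∀ b, b ≠ u → ¬ Γ.Adj u b → 2 ≤ (Γ.neighborSet b ∩ Γ.neighborSet u).ncard →
        2 ≤ (Γ.neighborSet a ∩ Γ.neighborSet u).ncard := by
    by_cases hex : ∃ b, b ≠ u ∧ ¬ Γ.Adj u b ∧ 2 ≤ (Γ.neighborSet b ∩ Γ.neighborSet u).ncard
    · obtain ⟨b, hbu, hub, h2⟩ := hex
      obtain ⟨x, hx⟩ : (Γ.neighborSet b ∩ Γ.neighborSet u).Nonempty :=
        (Set.ncard_pos (Set.toFinite _)).1 (by omega)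
      exact ⟨b, ⟨x, hx.2, hx.1.symm⟩, hub, hbu, fun _ _ _ _ => h2⟩
    · obtain ⟨x, a, hx, ha, hxa⟩ := exists_adj_mem_notMem hΓ (A := insert u (Γ.neighborSet u))
        ⟨u, by simp⟩ (by
          intro h
          rw [h, Set.ncard_univ] at hcardN
          omega)
      simp only [Set.mem_insert_iff, SimpleGraph.mem_neighborSet, not_or] at hx ha
      refine ⟨a, ⟨x, hx.resolve_left ?_, hxa⟩, ha.2, ha.1,
        fun b h1 h2 h3 => absurd ⟨b, h1, h2, h3⟩ hex⟩
      rintro rfl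
      exact ha.2 hxa
  have hcard₀ : (insert a (insert u (Γ.neighborSet u))).ncard = 5 := by
    rw [Set.ncard_insert_of_notMem (by simp [hau, haN]), hcardN]
  obtain ⟨A, hA₀, hA, hAn⟩ := exists_superset_ncard_eq hΓ (k := k) (by omega)
    (A₀ := insert a (insert u (Γ.neighborSet u))) ⟨a, by simp⟩
    (by
      rintro y (rfl | rfl | hy)
      · exact ⟨x, by simp [hxu], hxa.symm⟩
      · exact ⟨x, by simp [hxu], hxu⟩
      · exact ⟨u, by simp, hy.symm⟩) (by omega)
  have ha : a ∈ A := hA₀ (by simp)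
  have hu : u ∈ A := hA₀ (by simp)
  have hN : Γ.neighborSet u ⊆ A := fun y hy => hA₀ (by simp [hy])
  suffices ∃ c, IsAvoidingTour Γ A (2 * k) c by
    obtain ⟨c, hc⟩ := this
    exact ⟨A, c, hu, hN, hc⟩
  by_cases hk6 : 6 ≤ k
  · exact exists_tour_of_six_le (fun x => (hdeg x).le) hk6 hV hA hAn
  by_contra hno
  obtain ⟨F, hF, ⟨a₀, b₀, ha₀, hab₀⟩, hcut, hsum⟩ :=
    exists_obstruction Γ A (by omega) hA hV hno
  have hAeq : insert a (insert u (Γ.neighborSet u)) = A :=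
    Set.eq_of_subset_of_ncard_le hA₀ (by omega) (Set.toFinite _)
  have hsingle : ∀ p ∈ A, (F.neighborSet p).ncard + 1 ≤ (Γ.neighborSet p).ncard := by
    intro p hp
    obtain ⟨y, hy, hpy⟩ := hAn p hp
    rw [← Set.ncard_singleton y]
    exact ncard_neighborSet_add_le hF hcut hp (by simpa) (by simpa)
  have hb₀ : b₀ ∉ A := (hcut _ _ hab₀).1 ha₀
  have hb3 : (F.neighborSet b₀).ncard ≤ 3 :=
    (Set.ncard_le_ncard fun y hy => hF hy).trans (hdeg b₀).le
  have hb3' : 3 ≤ (F.neighborSet b₀).ncard := by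
    have h1 := hsum a₀ b₀ ha₀ hab₀
    have h2 := hsingle a₀ ha₀
    have h3 := hdeg a₀
    omega
  have hFA := neighborSet_subset_of_cut hcut hb₀
  have hFsum : ∀ p, F.Adj b₀ p → 2 ≤ (F.neighborSet p).ncard := fun p hp => by
    have := hsum p b₀ (hFA hp) hp.symm
    omega
  have hFu : (F.neighborSet u).ncard = 0 := by
    have := ncard_neighborSet_add_le hF hcut hu hN (fun y hy => hy)
    omega
  have hsub : F.neighborSet b₀ ⊆ insert a (Γ.neighborSet u) := by
    intro p hp
    have h1 : p ∈ A := hFA hp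
    rw [← hAeq] at h1
    rcases h1 with rfl | rfl | h1
    · simp
    · have := hFsum _ hp
      omega
    · exact Or.inr h1
  -- At least two of the three neighbours of `b₀` lie in `N(u)`, so the choice of `a` gives the same
  -- for `a`. This lowers the `F`-degree of `a` too far for `a` to be joined to `b₀`.
  have h2 : 2 ≤ (Γ.neighborSet a ∩ Γ.neighborSet u).ncard := by
    refine hmax b₀ (by rintro rfl; exact hb₀ hu) (fun h => hb₀ (hN h)) ?_
    have h3 : F.neighborSet b₀ \ {a} ⊆ Γ.neighborSet b₀ ∩ Γ.neighborSet u := fun p hp =>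
      ⟨hF hp.1, (hsub hp.1).resolve_left hp.2⟩
    have h4 := Set.ncard_le_ncard h3
    have h5 := Set.pred_ncard_le_ncard_sdiff_singleton (F.neighborSet b₀) a
    omega
  have hFa : (F.neighborSet a).ncard ≤ 1 := by
    have := ncard_neighborSet_add_le hF hcut ha (S := Γ.neighborSet a ∩ Γ.neighborSet u)
      (fun y hy => hN hy.2) (fun y hy => hy.1)
    have := hdeg a
    omega
  have hsub' : F.neighborSet b₀ ⊆ Γ.neighborSet u := by
    intro p hp
    refine (hsub hp).resolve_left ?_
    rintro rfl
    have := hFsum _ hp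
    omega
  have heq : F.neighborSet b₀ = Γ.neighborSet u :=
    Set.eq_of_subset_of_ncard_le hsub' (by rw [hdeg]; exact hb3') (Set.toFinite _)
  -- A common neighbour `p` of `a` and `u` has two neighbours in `A`, hence `F`-degree at most `1`,
  -- yet it is joined to `b₀`.
  obtain ⟨p, hpa, hpu⟩ : (Γ.neighborSet a ∩ Γ.neighborSet u).Nonempty :=
    (Set.ncard_pos (Set.toFinite _)).1 (by omega)
  have hp := hFsum p (show p ∈ F.neighborSet b₀ from heq ▸ hpu)
  have := ncard_neighborSet_add_le hF hcut (hN hpu) (S := {a, u})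
    (by rintro x (rfl | rfl) <;> assumption)
    (by
      rintro x (rfl | rfl)
      · exact hpa.symm
      · exact hpu.symm)
  rw [Set.ncard_pair hau] at this
  have := hdeg p
  omega

end LargeOrder

/-! ### Twins, that is, vertices with equal neighbourhoods, in cubic graphs of order eight. -/

section OrderEight

variable {V : Type*} [Finite V] {Γ : SimpleGraph V}

lemma ncard_quadruple {a b c d : V} (hab : a ≠ b) (hac : a ≠ c) (had : a ≠ d) (hbc : b ≠ c)
    (hbd : b ≠ d) (hcd : c ≠ d) : ({a, b, c, d} : Set V).ncard = 4 := by
  rw [Set.ncard_insert_of_notMem (by simp [hab, hac, had]), ncard_triple hbc hbd hcd]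

lemma not_four_adj (hdeg : ∀ x, (Γ.neighborSet x).ncard = 3) {p a b c d : V} (ha : Γ.Adj p a)
    (hb : Γ.Adj p b) (hc : Γ.Adj p c) (hd : Γ.Adj p d) (hab : a ≠ b) (hac : a ≠ c) (had : a ≠ d)
    (hbc : b ≠ c) (hbd : b ≠ d) (hcd : c ≠ d) : False := by
  have hsub : ({a, b, c, d} : Set V) ⊆ Γ.neighborSet p := by
    rintro x (rfl | rfl | rfl | rfl) <;> assumption
  have := Set.ncard_le_ncard hsub
  rw [ncard_quadruple hab hac had hbc hbd hcd, hdeg] at this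
  omega

/-- Three twins and their common neighbours span a `K_{3,3}`, which has no room for further edges
and would be the whole graph. -/
lemma not_three_twins (hΓ : Γ.Connected) (hV : 6 < Nat.card V)
    (hdeg : ∀ x, (Γ.neighborSet x).ncard = 3) {x y t : V} (hxy : x ≠ y) (hxt : x ≠ t)
    (hyt : y ≠ t) (hy : Γ.neighborSet x = Γ.neighborSet y)
    (ht : Γ.neighborSet x = Γ.neighborSet t) : False := by
  obtain ⟨a, b, ha, hb, hab⟩ := exists_adj_mem_notMem hΓ (A := {x, y, t} ∪ Γ.neighborSet x)
    ⟨x, by simp⟩ (by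
      intro h
      have h1 := Set.ncard_union_le {x, y, t} (Γ.neighborSet x)
      rw [h, Set.ncard_univ, ncard_triple hxy hxt hyt, hdeg] at h1
      omega)
  simp only [Set.mem_union, Set.mem_insert_iff, Set.mem_singleton_iff,
    SimpleGraph.mem_neighborSet, not_or] at ha hb
  have hiff : ∀ q, (Γ.Adj x q ↔ Γ.Adj y q) ∧ (Γ.Adj x q ↔ Γ.Adj t q) := fun q =>
    ⟨Set.ext_iff.1 hy q, Set.ext_iff.1 ht q⟩
  rcases ha with (rfl | rfl | rfl) | ha
  · exact hb.2 hab
  · exact hb.2 ((hiff b).1.2 hab)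
  · exact hb.2 ((hiff b).2.2 hab)
  · exact not_four_adj hdeg ha.symm ((hiff a).1.1 ha).symm ((hiff a).2.1 ha).symm hab hxy hxt
      (Ne.symm hb.1.1) hyt (Ne.symm hb.1.2.1) (Ne.symm hb.1.2.2)

/-- In a connected cubic graph of order `8`, at most one pair of vertices has equal
neighbourhoods. -/
lemma twins_unique (hΓ : Γ.Connected) (hV : Nat.card V = 8)
    (hdeg : ∀ x, (Γ.neighborSet x).ncard = 3) {x y s t : V} (hxy : x ≠ y) (hst : s ≠ t)
    (hy : Γ.neighborSet x = Γ.neighborSet y) (ht : Γ.neighborSet s = Γ.neighborSet t) :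
    s = x ∨ s = y := by
  by_contra! hs
  by_cases htx : t = x
  · subst htx
    exact not_three_twins hΓ (by omega) hdeg hxy hs.1.symm hs.2.symm hy ht.symm
  by_cases hty : t = y
  · subst hty
    exact not_three_twins hΓ (by omega) hdeg hxy hs.1.symm hs.2.symm hy (hy.trans ht.symm)
  have hiff1 : ∀ q, Γ.Adj x q ↔ Γ.Adj y q := fun q => Set.ext_iff.1 hy q
  have hiff2 : ∀ q, Γ.Adj s q ↔ Γ.Adj t q := fun q => Set.ext_iff.1 ht q
  -- A common neighbour of `x` and `s` would be adjacent to all of `x, y, s, t`.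
  have hdisj : Disjoint (Γ.neighborSet x) (Γ.neighborSet s) := by
    rw [Set.disjoint_left]
    intro p hpx hps
    exact not_four_adj hdeg (Γ.symm.symm _ _ hpx) ((hiff1 p).1 hpx).symm (Γ.symm.symm _ _ hps)
      ((hiff2 p).1 hps).symm hxy hs.1.symm (Ne.symm htx) hs.2.symm (Ne.symm hty) hst
  have hNN : (Γ.neighborSet x ∪ Γ.neighborSet s).ncard = 6 := by
    rw [Set.ncard_union_eq hdisj, hdeg, hdeg]
  have hxx : ¬ Γ.Adj x x := Γ.loopless.irrefl x
  have hss : ¬ Γ.Adj s s := Γ.loopless.irrefl s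
  by_cases hsx : Γ.Adj s x
  · have hsy : Γ.Adj s y := ((hiff1 s).1 hsx.symm).symm
    have hxt : Γ.Adj x t := ((hiff2 x).1 hsx).symm
    have hcompl : (Γ.neighborSet x ∪ Γ.neighborSet s)ᶜ.ncard = 2 := by
      have := Set.ncard_add_ncard_compl (Γ.neighborSet x ∪ Γ.neighborSet s)
      omega
    obtain ⟨g, h, hgh, heq⟩ := Set.ncard_eq_two.1 hcompl
    obtain ⟨r, hr, hrst⟩ : ∃ r ∈ Γ.neighborSet x, r ∉ ({s, t} : Set V) := by
      by_contra! hall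
      have := Set.ncard_le_ncard (show Γ.neighborSet x ⊆ {s, t} from hall)
      rw [Set.ncard_pair hst, hdeg] at this
      omega
    have hmem : ∀ q, q ∈ ({g, h} : Set V) → ¬ Γ.Adj x q ∧ ¬ Γ.Adj s q := by
      intro q hq
      rw [← heq] at hq
      simpa using hq
    have hg := hmem g (by simp)
    have hh := hmem h (by simp)
    -- Such a `q` has no neighbour among `x, y, s, t`, so its three neighbours are all the remaining
    -- vertices, `r` included. With `q = g, h`, the vertex `r` gets the four neighbours `x, y, g,
    -- h`.
    have hadj : ∀ q, ¬ Γ.Adj x q → ¬ Γ.Adj s q → q ≠ r → Γ.Adj q r := by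
      intro q hq1 hq2 hqr
      by_contra hqr'
      have hqx : q ≠ x := fun h => hq2 (h ▸ hsx)
      have hqy : q ≠ y := fun h => hq2 (h ▸ hsy)
      have hqs : q ≠ s := fun h => hq1 (h ▸ hsx.symm)
      have hqt : q ≠ t := fun h => hq1 (h ▸ hxt)
      have h1 : r ∉ ({x, y, s, t} : Set V) := by
        rintro (rfl | rfl | rfl | rfl)
        · exact hxx hr
        · exact hxx ((hiff1 x).2 (Γ.symm.symm _ _ hr))
        · simp at hrst
        · simp at hrst
      have h2 : q ∉ insert r ({x, y, s, t} : Set V) := by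
        simp [hqx, hqy, hqs, hqt, hqr]
      have hc : (insert q (insert r ({x, y, s, t} : Set V))).ncard = 6 := by
        rw [Set.ncard_insert_of_notMem h2, Set.ncard_insert_of_notMem h1,
          ncard_quadruple hxy hs.1.symm (Ne.symm htx) hs.2.symm (Ne.symm hty) hst]
      have hsub : Γ.neighborSet q ⊆ (insert q (insert r ({x, y, s, t} : Set V)))ᶜ := by
        intro p hp hp'
        have hp : Γ.Adj q p := hp
        rcases hp' with rfl | rfl | rfl | rfl | rfl | rfl
        · exact hp.ne rfl
        · exact hqr' hp
        · exact hq1 hp.symm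
        · exact hq1 ((hiff1 q).2 hp.symm)
        · exact hq2 hp.symm
        · exact hq2 ((hiff2 q).2 hp.symm)
      have h3 := Set.ncard_le_ncard hsub
      have h4 := Set.ncard_add_ncard_compl (insert q (insert r ({x, y, s, t} : Set V)))
      rw [hdeg] at h3
      omega
    have hgr : g ≠ r := fun h => hg.1 (h ▸ hr)
    have hhr : h ≠ r := fun h' => hh.1 (h' ▸ hr)
    exact not_four_adj hdeg (Γ.symm.symm _ _ hr) ((hiff1 r).1 hr).symm (hadj g hg.1 hg.2 hgr).symm
      (hadj h hh.1 hh.2 hhr).symm hxy (fun h => hg.2 (h ▸ hsx)) (fun h => hh.2 (h ▸ hsx))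
      (fun h => hg.2 (h ▸ hsy)) (fun h => hh.2 (h ▸ hsy)) hgh
  -- Here four vertices lie outside two disjoint triples in a set of eight.
  · have hsub : ({x, y, s, t} : Set V) ⊆ (Γ.neighborSet x ∪ Γ.neighborSet s)ᶜ := by
      rintro q (rfl | rfl | rfl | rfl) (h | h)
      · exact hxx h
      · exact hsx h
      · exact hxx ((hiff1 x).2 (Γ.symm.symm _ _ h))
      · exact hsx ((hiff1 s).2 (Γ.symm.symm _ _ h)).symm
      · exact hsx (Γ.symm.symm _ _ h)
      · exact hss h
      · exact hsx ((hiff2 x).2 (Γ.symm.symm _ _ h))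
      · exact hss ((hiff2 s).2 (Γ.symm.symm _ _ h))
    have h1 := Set.ncard_le_ncard hsub
    rw [ncard_quadruple hxy hs.1.symm (Ne.symm htx) hs.2.symm (Ne.symm hty) hst] at h1
    have := Set.ncard_add_ncard_compl (Γ.neighborSet x ∪ Γ.neighborSet s)
    omega

/-- If `x, y` are twins, they and their neighbours are only five vertices. Any other vertex works,
since every pair of twins meets `{x, y}`. -/
lemma exists_vertex_away_from_twins (hΓ : Γ.Connected) (hV : Nat.card V = 8)
    (hdeg : ∀ x, (Γ.neighborSet x).ncard = 3) :
    ∃ u, (∀ t, Γ.neighborSet t = Γ.neighborSet u → t = u) ∧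
      ∀ s t, Γ.Adj u s → Γ.Adj u t → Γ.neighborSet s = Γ.neighborSet t → s = t := by
  by_cases hex : ∃ x y, x ≠ y ∧ Γ.neighborSet x = Γ.neighborSet y
  · obtain ⟨x, y, hxy, hN⟩ := hex
    obtain ⟨g, hg⟩ : ∃ g, g ∉ {x, y} ∪ Γ.neighborSet x := by
      by_contra! hall
      have h1 := Set.ncard_union_le {x, y} (Γ.neighborSet x)
      rw [Set.eq_univ_of_forall hall, Set.ncard_univ, Set.ncard_pair hxy, hdeg] at h1
      omega
    simp only [Set.mem_union, Set.mem_insert_iff, Set.mem_singleton_iff,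
      SimpleGraph.mem_neighborSet, not_or] at hg
    refine ⟨g, fun t ht => ?_, fun s t hs ht hst => ?_⟩
    · by_contra hne
      rcases twins_unique hΓ hV hdeg hxy (Ne.symm hne) hN ht.symm with h | h
      · exact hg.1.1 h
      · exact hg.1.2 h
    · by_contra hne
      rcases twins_unique hΓ hV hdeg hxy hne hN hst with rfl | rfl
      · exact hg.2 hs.symm
      · exact hg.2 ((Set.ext_iff.1 hN g).2 hs.symm)
  · push Not at hex
    obtain ⟨u⟩ := hΓ.nonempty
    exact ⟨u, fun t ht => by_contra fun h => hex t u h ht,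
      fun s t _ _ hst => by_contra fun h => hex s t h hst⟩

end OrderEight

/-! ### Recognizing the cube as the only exception of order eight. -/

section Cube

instance : DecidableRel cube.Adj := fun s t => inferInstanceAs (Decidable (hammingDist s t = 1))

/-- The cube vertex as a binary number. -/
def cubeCode (s : Fin 3 → Bool) : Fin 8 :=
  (if s 0 then 1 else 0) + (if s 1 then 2 else 0) + (if s 2 then 4 else 0)

lemma cubeCode_injective : Function.Injective cubeCode := by
  intro s t
  revert s t
  decide

lemma cube_adj_cubeCode : ∀ s t : Fin 3 → Bool, cube.Adj s t → cubeCode s < cubeCode t →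
    (cubeCode s, cubeCode t) ∈ [((0 : Fin 8), (1 : Fin 8)), (0, 2), (0, 4), (1, 3), (1, 5), (2, 3),
      (2, 6), (3, 7), (4, 5), (4, 6), (5, 7), (6, 7)] := by
  decide

lemma cube_ncard_neighborSet (s : Fin 3 → Bool) : (cube.neighborSet s).ncard = 3 := by
  rw [Set.ncard_eq_toFinset_card']
  revert s
  decide

/-- Both graphs are cubic of order eight, so an injection preserving edges already exhausts each
neighbourhood. -/
lemma cube_iso_of_injective {V : Type*} [Finite V] {Γ : SimpleGraph V} (hV : Nat.card V = 8)
    (hdeg : ∀ x, (Γ.neighborSet x).ncard = 3) {f : (Fin 3 → Bool) → V}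
    (hf : Function.Injective f) (hadj : ∀ s t, cube.Adj s t → Γ.Adj (f s) (f t)) :
    Nonempty (Γ ≃g cube) := by
  have hbij : Function.Bijective f :=
    (Nat.bijective_iff_injective_and_card f).2 ⟨hf, by simp [hV]⟩
  refine ⟨RelIso.symm ⟨Equiv.ofBijective f hbij, ?_⟩⟩
  intro s t
  refine ⟨fun h => ?_, hadj s t⟩
  have heq : f '' cube.neighborSet s = Γ.neighborSet (f s) := by
    refine Set.eq_of_subset_of_ncard_le ?_ ?_ (Set.toFinite _)
    · rintro _ ⟨t, ht, rfl⟩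
      exact hadj s t ht
    · rw [hdeg, Set.ncard_image_of_injective _ hf, cube_ncard_neighborSet]
  have h' : f t ∈ Γ.neighborSet (f s) := h
  rw [← heq] at h'
  obtain ⟨t', ht', hft⟩ := h'
  exact hf hft ▸ ht'

lemma cube_iso_of_adj {V : Type*} [Finite V] {Γ : SimpleGraph V} (hV : Nat.card V = 8)
    (hdeg : ∀ x, (Γ.neighborSet x).ncard = 3) {u x y z b₁ b₂ b₃ b₄ : V}
    (hp : Function.Injective ![u, x, y, b₁, z, b₂, b₃, b₄]) (hux : Γ.Adj u x) (huy : Γ.Adj u y)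
    (huz : Γ.Adj u z) (hxb₁ : Γ.Adj x b₁) (hxb₂ : Γ.Adj x b₂) (hyb₁ : Γ.Adj y b₁)
    (hyb₃ : Γ.Adj y b₃) (hb₁b₄ : Γ.Adj b₁ b₄) (hzb₂ : Γ.Adj z b₂) (hzb₃ : Γ.Adj z b₃)
    (hb₂b₄ : Γ.Adj b₂ b₄) (hb₃b₄ : Γ.Adj b₃ b₄) : Nonempty (Γ ≃g cube) := by
  refine (cube_iso_of_injective hV hdeg
    (f := fun s => ![u, x, y, b₁, z, b₂, b₃, b₄] (cubeCode s)) (hp.comp cubeCode_injective) ?_)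
  have hlt : ∀ s t, cube.Adj s t → cubeCode s < cubeCode t →
      Γ.Adj (![u, x, y, b₁, z, b₂, b₃, b₄] (cubeCode s))
        (![u, x, y, b₁, z, b₂, b₃, b₄] (cubeCode t)) := by
    intro s t hst hlt
    have hmem := cube_adj_cubeCode s t hst hlt
    generalize cubeCode s = i at hmem
    generalize cubeCode t = j at hmem
    simp only [List.mem_cons, Prod.mk.injEq, List.not_mem_nil, or_false] at hmem
    rcases hmem with ⟨rfl, rfl⟩ | ⟨rfl, rfl⟩ | ⟨rfl, rfl⟩ | ⟨rfl, rfl⟩ | ⟨rfl, rfl⟩ | ⟨rfl, rfl⟩ |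
      ⟨rfl, rfl⟩ | ⟨rfl, rfl⟩ | ⟨rfl, rfl⟩ | ⟨rfl, rfl⟩ | ⟨rfl, rfl⟩ | ⟨rfl, rfl⟩
    · exact hux
    · exact huy
    · exact huz
    · exact hxb₁
    · exact hxb₂
    · exact hyb₁
    · exact hyb₃
    · exact hb₁b₄
    · exact hzb₂
    · exact hzb₃
    · exact hb₂b₄
    · exact hb₃b₄
  intro s t hst
  rcases lt_trichotomy (cubeCode s) (cubeCode t) with h | h | h
  · exact hlt s t hst h
  · exact absurd (cubeCode_injective h) hst.ne
  · exact (hlt t s hst.symm h).symm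

/-- With `A` the closed neighbourhood of `u`, an obstruction has all its nonzero degrees equal to
`2`. It is a `4`-cycle or a `6`-cycle between `N(u)` and the complement of `A`. A `4`-cycle gives
twins in `N(u)`, and a `6`-cycle completes to the cube. -/
lemma exists_tour_of_order_eight {V : Type*} [Finite V] {Γ : SimpleGraph V} (hΓ : Γ.Connected)
    (hV : Nat.card V = 8) (hdeg : ∀ x, (Γ.neighborSet x).ncard = 3)
    (hcube : ¬ Nonempty (Γ ≃g cube)) :
    ∃ u A c, u ∈ A ∧ Γ.neighborSet u ⊆ A ∧ IsAvoidingTour Γ A (2 * 4) c := by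
  obtain ⟨u, htwin, htwin'⟩ := exists_vertex_away_from_twins hΓ hV hdeg
  have huN : u ∉ Γ.neighborSet u := Γ.loopless.irrefl u
  have hA : (insert u (Γ.neighborSet u)).ncard = 4 := by
    rw [Set.ncard_insert_of_notMem huN, hdeg]
  refine ⟨u, insert u (Γ.neighborSet u), ?_⟩
  by_contra! hno
  obtain ⟨F, hF, ⟨x, b₁, hx, hxb₁⟩, hcut, hsum⟩ := exists_obstruction Γ
    (insert u (Γ.neighborSet u)) (by omega) hA hV
    (fun ⟨c, hc⟩ => hno c (by simp) (Set.subset_insert _ _) hc)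
  have hFu : ∀ b, ¬ F.Adj u b := by
    intro b hb
    exact (hcut u b hb).1 (by simp) (Or.inr (hF hb))
  have hFA : ∀ p b, p ∈ insert u (Γ.neighborSet u) → F.Adj p b →
      Γ.Adj u p ∧ b ≠ u ∧ ¬ Γ.Adj u b := by
    rintro p b (rfl | hp) hpb
    · exact absurd hpb (hFu b)
    · have := (hcut p b hpb).1 (Or.inr hp)
      simp only [Set.mem_insert_iff, SimpleGraph.mem_neighborSet, not_or] at this
      exact ⟨hp, this⟩
  have hFp : ∀ p, Γ.Adj u p → (F.neighborSet p).ncard ≤ 2 := by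
    intro p hp
    have := ncard_neighborSet_add_le hF hcut (a := p) (Or.inr hp) (S := {u}) (by simp)
      (by simpa using hp.symm)
    rw [hdeg, Set.ncard_singleton] at this
    omega
  -- A vertex of `F`-degree `3` off `A` would be a twin of `u`.
  have hFb : ∀ b, b ≠ u → ¬ Γ.Adj u b → (F.neighborSet b).ncard ≤ 2 := by
    intro b hbu hub
    by_contra! hlt
    have hbA : b ∉ insert u (Γ.neighborSet u) := by simp [hbu, hub]
    have hsub : F.neighborSet b ⊆ Γ.neighborSet u := fun p hp =>
      (hFA p b (neighborSet_subset_of_cut hcut hbA hp) (F.symm.symm _ _ hp)).1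
    have h1 := Set.eq_of_subset_of_ncard_le hsub (by rw [hdeg]; exact hlt) (Set.toFinite _)
    have h2 := Set.eq_of_subset_of_ncard_le (s := F.neighborSet b) (t := Γ.neighborSet b)
      (fun p hp => hF hp) (by rw [hdeg]; exact hlt) (Set.toFinite _)
    exact hbu (htwin b (h2.symm.trans h1))
  have hboth : ∀ p b, Γ.Adj u p → F.Adj p b →
      (F.neighborSet p).ncard = 2 ∧ (F.neighborSet b).ncard = 2 := by
    intro p b hp hpb
    have h1 := hsum p b (Or.inr hp) hpb
    have h2 := hFA p b (Or.inr hp) hpb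
    have h3 := hFp p hp
    have h4 := hFb b h2.2.1 h2.2.2
    omega
  have hother : ∀ p q, (F.neighborSet p).ncard = 2 → F.Adj p q →
      ∃ r, r ≠ q ∧ F.Adj p r ∧ ∀ t, F.Adj p t → t = q ∨ t = r := by
    intro p q h2 hpq
    obtain ⟨r, hr, hrq⟩ := Set.exists_ne_of_one_lt_ncard (s := F.neighborSet p) (by omega) q
    refine ⟨r, hrq, hr, fun t ht => ?_⟩
    have hsub : ({q, r} : Set V) ⊆ F.neighborSet p := by
      rintro y (rfl | rfl) <;> assumption
    have := Set.eq_of_subset_of_ncard_le hsub (by rw [Set.ncard_pair hrq.symm, h2])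
      (Set.toFinite _)
    have ht' : t ∈ F.neighborSet p := ht
    rw [← this] at ht'
    exact ht'
  have hback : ∀ b p, b ≠ u → ¬ Γ.Adj u b → F.Adj b p → Γ.Adj u p := by
    intro b p hbu hub hbp
    have hbA : b ∉ insert u (Γ.neighborSet u) := by simp [hbu, hub]
    exact (hFA p b (neighborSet_subset_of_cut hcut hbA hbp) hbp.symm).1
  obtain ⟨hux, hb₁u, hb₁⟩ := hFA x b₁ hx hxb₁
  obtain ⟨y, hyx, hb₁y, hb₁N⟩ := hother b₁ x (hboth x b₁ hux hxb₁).2 hxb₁.symm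
  have huy := hback b₁ y hb₁u hb₁ hb₁y
  obtain ⟨b₂, hb₂b₁, hxb₂, hxN⟩ := hother x b₁ (hboth x b₁ hux hxb₁).1 hxb₁
  obtain ⟨-, hb₂u, hb₂⟩ := hFA x b₂ hx hxb₂
  obtain ⟨z, hzx, hb₂z, hb₂N⟩ := hother b₂ x (hboth x b₂ hux hxb₂).2 hxb₂.symm
  have huz := hback b₂ z hb₂u hb₂ hb₂z
  have hΓx : ∀ q, Γ.Adj x q → q = u ∨ q = b₁ ∨ q = b₂ := fun q hq =>
    eq_or_eq_or_eq_of_ncard_le_three (hdeg x).le hux.symm (hF hxb₁) (hF hxb₂) hb₁u.symm hb₂u.symm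
      hb₂b₁.symm hq
  -- If `F` closed up to the `4`-cycle `x b₁ y b₂`, then `x` and `y` would be twins adjacent to `u`.
  have hzy : z ≠ y := by
    rintro rfl
    refine hyx (htwin' z x huz hux ?_)
    refine (Set.eq_of_subset_of_ncard_le ?_ (by rw [hdeg, hdeg]) (Set.toFinite _)).symm
    intro q hq
    rcases hΓx q hq with rfl | rfl | rfl
    · exact huz.symm
    · exact (hF hb₁y).symm
    · exact (hF hb₂z).symm
  obtain ⟨b₃, hb₃b₁, hyb₃, hyN⟩ := hother y b₁ (hboth y b₁ huy hb₁y.symm).1 hb₁y.symm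
  obtain ⟨-, hb₃u, hb₃⟩ := hFA y b₃ (Or.inr huy) hyb₃
  have hb₃b₂ : b₃ ≠ b₂ := by
    rintro rfl
    rcases hb₂N y hyb₃.symm with h | h
    · exact hyx h
    · exact hzy h.symm
  have hb₃z : F.Adj b₃ z := by
    obtain ⟨q, hqy, hb₃q, -⟩ := hother b₃ y (hboth y b₃ huy hyb₃).2 hyb₃.symm
    have huq := hback b₃ q hb₃u hb₃ hb₃q
    rcases eq_or_eq_or_eq_of_ncard_le_three (hdeg u).le hux huy huz hyx.symm hzx.symm hzy.symm huq
      with rfl | rfl | rfl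
    · rcases hxN b₃ hb₃q.symm with h | h
      · exact absurd h hb₃b₁
      · exact absurd h hb₃b₂
    · exact absurd rfl hqy
    · exact hb₃q
  have hΓy : ∀ q, Γ.Adj y q → q = u ∨ q = b₁ ∨ q = b₃ := fun q hq =>
    eq_or_eq_or_eq_of_ncard_le_three (hdeg y).le huy.symm (hF hb₁y.symm) (hF hyb₃) hb₁u.symm
      hb₃u.symm hb₃b₁.symm hq
  have hΓz : ∀ q, Γ.Adj z q → q = u ∨ q = b₂ ∨ q = b₃ := fun q hq =>
    eq_or_eq_or_eq_of_ncard_le_three (hdeg z).le huz.symm (hF hb₂z.symm) (hF hb₃z.symm) hb₂u.symm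
      hb₃u.symm hb₃b₂.symm hq
  have hΓu : ∀ q, Γ.Adj u q → q = x ∨ q = y ∨ q = z := fun q hq =>
    eq_or_eq_or_eq_of_ncard_le_three (hdeg u).le hux huy huz hyx.symm hzx.symm hzy.symm hq
  have hnx : ∀ b, ¬ Γ.Adj u b → b ≠ x ∧ b ≠ y ∧ b ≠ z := fun b hb =>
    ⟨fun h => hb (h ▸ hux), fun h => hb (h ▸ huy), fun h => hb (h ▸ huz)⟩
  -- The eighth vertex. The vertices `u, x, y, z` already have their three neighbours elsewhere, so
  -- it is joined to `b₁, b₂, b₃`.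
  obtain ⟨b₄, hb₄⟩ : ∃ b₄, b₄ ∉ insert u (Γ.neighborSet u) ∪ {b₁, b₂, b₃} := by
    by_contra! hall
    have h1 := Set.ncard_union_le (insert u (Γ.neighborSet u)) {b₁, b₂, b₃}
    rw [Set.eq_univ_of_forall hall, Set.ncard_univ, hA,
      ncard_triple hb₂b₁.symm hb₃b₁.symm hb₃b₂.symm] at h1
    omega
  simp only [Set.mem_union, Set.mem_insert_iff, Set.mem_singleton_iff,
    SimpleGraph.mem_neighborSet, not_or] at hb₄
  obtain ⟨⟨hb₄u, hb₄N⟩, hb₄b₁, hb₄b₂, hb₄b₃⟩ := hb₄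
  have d1 := hnx b₁ hb₁
  have d2 := hnx b₂ hb₂
  have d3 := hnx b₃ hb₃
  have d4 := hnx b₄ hb₄N
  have e1 := hux.ne
  have e2 := huy.ne
  have e3 := huz.ne
  have hp : Function.Injective ![u, x, y, b₁, z, b₂, b₃, b₄] := by
    rw [← List.nodup_ofFn]
    simp only [List.ofFn_succ, List.ofFn_zero]
    simp
    grind
  have hsurj := ((Nat.bijective_iff_injective_and_card _).2 ⟨hp, by simp [hV]⟩).2
  have hb₄sub : Γ.neighborSet b₄ ⊆ {b₁, b₂, b₃} := by
    intro q hq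
    have hq : Γ.Adj b₄ q := hq
    have h1 : ¬ Γ.Adj b₄ x := fun h => by
      rcases hΓx _ h.symm with h | h | h <;> contradiction
    have h2 : ¬ Γ.Adj b₄ y := fun h => by
      rcases hΓy _ h.symm with h | h | h <;> contradiction
    have h3 : ¬ Γ.Adj b₄ z := fun h => by
      rcases hΓz _ h.symm with h | h | h <;> contradiction
    have h4 : ¬ Γ.Adj b₄ u := fun h => hb₄N h.symm
    have h5 : ¬ Γ.Adj b₄ b₄ := Γ.loopless.irrefl _
    obtain ⟨i, hi⟩ := hsurj q
    have hq' : q = u ∨ q = x ∨ q = y ∨ q = b₁ ∨ q = z ∨ q = b₂ ∨ q = b₃ ∨ q = b₄ := by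
      fin_cases i
      · exact .inl hi.symm
      · exact .inr (.inl hi.symm)
      · exact .inr (.inr (.inl hi.symm))
      · exact .inr (.inr (.inr (.inl hi.symm)))
      · exact .inr (.inr (.inr (.inr (.inl hi.symm))))
      · exact .inr (.inr (.inr (.inr (.inr (.inl hi.symm)))))
      · exact .inr (.inr (.inr (.inr (.inr (.inr (.inl hi.symm))))))
      · exact .inr (.inr (.inr (.inr (.inr (.inr (.inr hi.symm))))))
    rcases hq' with rfl | rfl | rfl | rfl | rfl | rfl | rfl | rfl
    · exact absurd hq h4
    · exact absurd hq h1
    · exact absurd hq h2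
    · simp
    · exact absurd hq h3
    · simp
    · simp
    · exact absurd hq h5
  have hb₄eq := Set.eq_of_subset_of_ncard_le hb₄sub
    (by rw [hdeg, ncard_triple hb₂b₁.symm hb₃b₁.symm hb₃b₂.symm]) (Set.toFinite _)
  have h41 : Γ.Adj b₄ b₁ := by
    rw [← SimpleGraph.mem_neighborSet, hb₄eq]; simp
  have h42 : Γ.Adj b₄ b₂ := by
    rw [← SimpleGraph.mem_neighborSet, hb₄eq]; simp
  have h43 : Γ.Adj b₄ b₃ := by
    rw [← SimpleGraph.mem_neighborSet, hb₄eq]; simp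
  exact hcube (cube_iso_of_adj hV hdeg hp hux huy huz (hF hxb₁) (hF hxb₂) (hF hb₁y.symm) (hF hyb₃)
    h41.symm (hF hb₂z.symm) (hF hb₃z.symm) h42.symm h43.symm)

end Cube

/-! ### Signed areas and half-planes. -/

section Orientation

/-- Twice the signed area of the triangle `p r z`. -/
def orient (p r z : Plane) : ℝ := (r 0 - p 0) * (z 1 - p 1) - (r 1 - p 1) * (z 0 - p 0)

lemma orient_rotate (p r z : Plane) : orient p r z = orient r z p := by
  unfold orient; ring

lemma orient_swap (p r z : Plane) : orient r p z = -orient p r z := by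
  unfold orient; ring

lemma orient_self_left (p r : Plane) : orient p r p = 0 := by
  unfold orient; ring

lemma orient_self_right (p r : Plane) : orient p r r = 0 := by
  unfold orient; ring

lemma orient_combo (p r z w : Plane) {s t : ℝ} (h : s + t = 1) :
    orient p r (s • z + t • w) = s * orient p r z + t * orient p r w := by
  obtain rfl : s = 1 - t := by linarith
  simp only [orient, PiLp.add_apply, PiLp.smul_apply, smul_eq_mul]
  ring

lemma continuous_orient (p r : Plane) : Continuous (orient p r) := by
  unfold orient; fun_prop

lemma convex_orient_nonpos (p r : Plane) : Convex ℝ {z | orient p r z ≤ 0} := by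
  intro z hz w hw s t hs ht hst
  simp only [Set.mem_ofPred_eq] at *
  rw [orient_combo p r z w hst]
  nlinarith [mul_nonneg hs (neg_nonneg.2 hz), mul_nonneg ht (neg_nonneg.2 hw)]

lemma convex_orient_neg (p r : Plane) : Convex ℝ {z | orient p r z < 0} := by
  intro z hz w hw s t hs ht hst
  simp only [Set.mem_ofPred_eq] at *
  rw [orient_combo p r z w hst]
  rcases hs.eq_or_lt with rfl | hs'
  · obtain rfl : t = 1 := by linarith
    linarith
  · nlinarith [mul_pos hs' (neg_pos.2 hz), mul_nonneg ht (neg_pos.2 hw).le]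

lemma orient_neg_of_mem_interior {s : Set Plane} {p r z : Plane} (hpr : p ≠ r)
    (hs : ∀ w ∈ s, orient p r w ≤ 0) (hz : z ∈ interior (convexHull ℝ s)) :
    orient p r z < 0 := by
  have hle : ∀ w ∈ convexHull ℝ s, orient p r w ≤ 0 :=
    convexHull_min hs (convex_orient_nonpos p r)
  refine lt_of_le_of_ne (hle z (interior_subset hz)) fun h0 => ?_
  -- A normal of the line `p r` on its positive side: a point of the hull on the line could be moved
  -- along `v` out of the half-plane without leaving the interior.
  let v : Plane := !₂[-(r 1 - p 1), r 0 - p 0]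
  have hcont : Continuous fun t : ℝ => z + t • v := by fun_prop
  have hev : ∀ᶠ t : ℝ in nhds 0, z + t • v ∈ interior (convexHull ℝ s) :=
    hcont.continuousAt.eventually_mem (isOpen_interior.mem_nhds (by simpa using hz))
  obtain ⟨t, ht, htpos⟩ :=
    ((hev.filter_mono nhdsWithin_le_nhds).and
      (self_mem_nhdsWithin (a := (0 : ℝ)) (s := Set.Ioi 0))).exists
  have h1 := hle _ (interior_subset ht)
  have h2 : orient p r (z + t • v) =
      orient p r z + t * ((r 0 - p 0) ^ 2 + (r 1 - p 1) ^ 2) := by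
    simp only [orient, v, PiLp.add_apply, PiLp.smul_apply, smul_eq_mul]
    simp
    ring
  rw [h2, h0, zero_add] at h1
  have h3 : (r 0 - p 0) ^ 2 + (r 1 - p 1) ^ 2 ≤ 0 := nonpos_of_mul_nonpos_right h1 htpos
  apply hpr
  ext i
  fin_cases i
  · simp; nlinarith [sq_nonneg (r 0 - p 0), sq_nonneg (r 1 - p 1)]
  · simp; nlinarith [sq_nonneg (r 0 - p 0), sq_nonneg (r 1 - p 1)]

/-- On the line `p r` the auxiliary points `m` and `m'` read off the two affine coefficients of `z`
as quotients of areas. -/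
lemma mem_segment_of_orient {p r z m m' : Plane} (hz : orient p r z = 0)
    (hm : orient p m r ≠ 0) (hmz : 0 ≤ orient p m z / orient p m r)
    (hm' : orient r m' p ≠ 0) (hmz' : 0 ≤ orient r m' z / orient r m' p) :
    z ∈ segment ℝ p r := by
  set t := orient p m z / orient p m r with ht
  have hzt : z = (1 - t) • p + t • r := by
    ext i
    simp only [PiLp.add_apply, PiLp.smul_apply, smul_eq_mul]
    have h1 : t * orient p m r = orient p m z := div_mul_cancel₀ _ hm
    apply mul_right_cancel₀ hm
    have h2 : ((1 - t) * p i + t * r i) * orient p m r =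
        p i * orient p m r + (r i - p i) * orient p m z := by
      rw [← h1]; ring
    rw [h2]
    unfold orient at hz ⊢
    fin_cases i
    · simp only [Fin.zero_eta]
      linear_combination (-(m 0 - p 0)) * hz
    · simp only [Fin.mk_one]
      linear_combination (-(m 1 - p 1)) * hz
  have h1 : orient r m' z = (1 - t) * orient r m' p := by
    rw [hzt, orient_combo _ _ _ _ (by ring), orient_self_left]
    ring
  rw [h1, mul_div_cancel_right₀ _ hm'] at hmz'
  exact ⟨1 - t, t, hmz', hmz, by ring, hzt.symm⟩

end Orientation

/-! ### Open convex quadrilaterals and their boundaries. -/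

section Quadrilateral

/-- The intersection of the open half-planes to the right of the four sides. -/
def openQuad (a b c d : Plane) : Set Plane :=
  {z | orient a b z < 0 ∧ orient b c z < 0 ∧ orient c d z < 0 ∧ orient d a z < 0}

variable {a b c d : Plane}

lemma isOpen_openQuad : IsOpen (openQuad a b c d) :=
  (isOpen_lt (continuous_orient _ _) continuous_const).inter <|
    (isOpen_lt (continuous_orient _ _) continuous_const).inter <|
      (isOpen_lt (continuous_orient _ _) continuous_const).inter
        (isOpen_lt (continuous_orient _ _) continuous_const)

lemma convex_openQuad : Convex ℝ (openQuad a b c d) :=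
  (convex_orient_neg _ _).inter <| (convex_orient_neg _ _).inter <|
    (convex_orient_neg _ _).inter (convex_orient_neg _ _)

lemma mem_convexHull_triangle {a b c z : Plane} {s : Set Plane} (ha : a ∈ s) (hb : b ∈ s)
    (hc : c ∈ s) (habc : orient a b c < 0) (h1 : orient a b z ≤ 0) (h2 : orient b c z ≤ 0)
    (h3 : orient c a z ≤ 0) : z ∈ convexHull ℝ s := by
  have hsum : orient b c z + orient c a z + orient a b z = orient a b c := by
    unfold orient; ring
  have hne := habc.ne
  have hz : z = (orient b c z / orient a b c) • a + (orient c a z / orient a b c) • b +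
      (orient a b z / orient a b c) • c := by
    ext i
    simp only [PiLp.add_apply, PiLp.smul_apply, smul_eq_mul]
    have : orient b c z / orient a b c * a i + orient c a z / orient a b c * b i +
        orient a b z / orient a b c * c i =
        (orient b c z * a i + orient c a z * b i + orient a b z * c i) / orient a b c := by ring
    rw [this, eq_div_iff hne]
    unfold orient
    fin_cases i
    · simp only [Fin.zero_eta]; ring
    · simp only [Fin.mk_one]; ring
  rw [hz]
  have hconv := convex_convexHull ℝ s
  exact hconv.sum_mem (t := (Finset.univ : Finset (Fin 3)))
    (w := ![orient b c z / orient a b c, orient c a z / orient a b c,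
      orient a b z / orient a b c]) (z := ![a, b, c])
    (by
      intro i _
      fin_cases i
      · exact div_nonneg_of_nonpos h2 habc.le
      · exact div_nonneg_of_nonpos h3 habc.le
      · exact div_nonneg_of_nonpos h1 habc.le)
    (by
      simp only [Fin.sum_univ_three, Matrix.cons_val_zero, Matrix.cons_val_one, Matrix.cons_val]
      rw [← add_div, ← add_div, hsum, div_self hne])
    (by
      intro i _
      fin_cases i
      · exact subset_convexHull ℝ s ha
      · exact subset_convexHull ℝ s hb
      · exact subset_convexHull ℝ s hc) |> fun h => by
        simpa [Fin.sum_univ_three] using h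

/-- The diagonal `ac` cuts the quadrilateral into two triangles, where barycentric coordinates
apply. -/
lemma openQuad_subset_convexHull {s : Set Plane} (ha : a ∈ s) (hb : b ∈ s) (hc : c ∈ s)
    (hd : d ∈ s) (habc : orient a b c < 0) (hacd : orient a c d < 0) :
    openQuad a b c d ⊆ convexHull ℝ s := by
  rintro z ⟨h1, h2, h3, h4⟩
  rcases le_total (orient a c z) 0 with h | h
  · exact mem_convexHull_triangle ha hc hd hacd h h3.le h4.le
  · refine mem_convexHull_triangle ha hb hc habc h1.le h2.le ?_
    rw [orient_swap]
    linarith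

lemma mem_segment_side (habc : orient a b c < 0) (habd : orient a b d < 0) {z : Plane}
    (hz : orient a b z = 0) (h2 : orient b c z ≤ 0) (h4 : orient d a z ≤ 0) :
    z ∈ segment ℝ a b := by
  have e1 : orient a d b = -orient a b d := by unfold orient; ring
  have e2 : orient b c a = orient a b c := by unfold orient; ring
  refine mem_segment_of_orient (m := d) (m' := c) hz (by rw [e1]; linarith) ?_
    (by rw [e2]; linarith) ?_
  · rw [e1, orient_swap d a, neg_div_neg_eq]
    exact div_nonneg_of_nonpos h4 habd.le
  · rw [e2]
    exact div_nonneg_of_nonpos h2 habc.le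

lemma frontier_openQuad (habc : orient a b c < 0) (habd : orient a b d < 0)
    (hacd : orient a c d < 0) (hbcd : orient b c d < 0) (hne : (openQuad a b c d).Nonempty) :
    frontier (openQuad a b c d) =
      segment ℝ a b ∪ segment ℝ b c ∪ segment ℝ c d ∪ segment ℝ d a := by
  have e1 : orient b c a = orient a b c := by unfold orient; ring
  have e2 : orient c d a = orient a c d := by unfold orient; ring
  have e3 : orient c d b = orient b c d := by unfold orient; ring
  have e4 : orient d a b = orient a b d := by unfold orient; ring
  have e5 : orient d a c = orient a c d := by unfold orient; ring
  have hcl : closure (openQuad a b c d) ⊆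
      {z | orient a b z ≤ 0 ∧ orient b c z ≤ 0 ∧ orient c d z ≤ 0 ∧ orient d a z ≤ 0} := by
    refine closure_minimal (fun z hz => ⟨hz.1.le, hz.2.1.le, hz.2.2.1.le, hz.2.2.2.le⟩) ?_
    exact (isClosed_le (continuous_orient _ _) continuous_const).inter <|
      (isClosed_le (continuous_orient _ _) continuous_const).inter <|
      (isClosed_le (continuous_orient _ _) continuous_const).inter
        (isClosed_le (continuous_orient _ _) continuous_const)
  -- The weak inequalities describe the closure: moving from `z` towards an inner point `w` makes
  -- all of them strict.
  have hcl' : ∀ z, orient a b z ≤ 0 → orient b c z ≤ 0 → orient c d z ≤ 0 → orient d a z ≤ 0 →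
      z ∈ closure (openQuad a b c d) := by
    intro z h1 h2 h3 h4
    obtain ⟨w, hw1, hw2, hw3, hw4⟩ := hne
    have hlim : Filter.Tendsto (fun t : ℝ => (1 - t) • z + t • w) (nhdsWithin 0 (Set.Ioo 0 1))
        (nhds z) := by
      have : Continuous fun t : ℝ => (1 - t) • z + t • w := by fun_prop
      have := this.tendsto 0
      simp only [sub_zero, one_smul, zero_smul, add_zero] at this
      exact this.mono_left nhdsWithin_le_nhds
    have : (nhdsWithin (0 : ℝ) (Set.Ioo 0 1)).NeBot := by
      rw [nhdsWithin_Ioo_eq_nhdsGT one_pos]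
      infer_instance
    refine mem_closure_of_tendsto hlim ?_
    filter_upwards [self_mem_nhdsWithin] with t ht
    have hneg : ∀ p r : Plane, orient p r z ≤ 0 → orient p r w < 0 →
        orient p r ((1 - t) • z + t • w) < 0 := by
      intro p r hz hw
      rw [orient_combo _ _ _ _ (by ring)]
      nlinarith [mul_nonneg (sub_nonneg.2 ht.2.le) (neg_nonneg.2 hz),
        mul_pos ht.1 (neg_pos.2 hw)]
    exact ⟨hneg _ _ h1 hw1, hneg _ _ h2 hw2, hneg _ _ h3 hw3, hneg _ _ h4 hw4⟩
  rw [isOpen_openQuad.frontier_eq]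
  ext z
  constructor
  · rintro ⟨hz, hz'⟩
    obtain ⟨h1, h2, h3, h4⟩ := hcl hz
    by_cases g1 : orient a b z = 0
    · exact .inl (.inl (.inl (mem_segment_side habc habd g1 h2 h4)))
    by_cases g2 : orient b c z = 0
    · exact .inl (.inl (.inr (mem_segment_side hbcd (e1.trans_lt habc) g2 h3 h1)))
    by_cases g3 : orient c d z = 0
    · exact .inl (.inr (mem_segment_side (e2.trans_lt hacd) (e3.trans_lt hbcd) g3 h4 h2))
    by_cases g4 : orient d a z = 0
    · exact .inr (mem_segment_side (e4.trans_lt habd) (e5.trans_lt hacd) g4 h1 h3)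
    exact absurd ⟨lt_of_le_of_ne h1 g1, lt_of_le_of_ne h2 g2, lt_of_le_of_ne h3 g3,
      lt_of_le_of_ne h4 g4⟩ hz'
  · have hseg : ∀ p r : Plane, orient a b p ≤ 0 ∧ orient b c p ≤ 0 ∧ orient c d p ≤ 0 ∧
        orient d a p ≤ 0 → orient a b r ≤ 0 ∧ orient b c r ≤ 0 ∧ orient c d r ≤ 0 ∧
        orient d a r ≤ 0 → z ∈ segment ℝ p r → z ∈ closure (openQuad a b c d) := by
      rintro p r ⟨p1, p2, p3, p4⟩ ⟨r1, r2, r3, r4⟩ hz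
      exact hcl' z ((convex_orient_nonpos a b).segment_subset p1 r1 hz)
        ((convex_orient_nonpos b c).segment_subset p2 r2 hz)
        ((convex_orient_nonpos c d).segment_subset p3 r3 hz)
        ((convex_orient_nonpos d a).segment_subset p4 r4 hz)
    have hzero : ∀ p r : Plane, z ∈ segment ℝ p r → orient p r z = 0 := by
      rintro p r ⟨s, t, -, -, hst, rfl⟩
      rw [orient_combo _ _ _ _ hst, orient_self_left, orient_self_right]
      ring
    have ha : orient a b a ≤ 0 ∧ orient b c a ≤ 0 ∧ orient c d a ≤ 0 ∧ orient d a a ≤ 0 :=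
      ⟨(orient_self_left _ _).le, (e1.trans_lt habc).le, (e2.trans_lt hacd).le,
        (orient_self_right _ _).le⟩
    have hb : orient a b b ≤ 0 ∧ orient b c b ≤ 0 ∧ orient c d b ≤ 0 ∧ orient d a b ≤ 0 :=
      ⟨(orient_self_right _ _).le, (orient_self_left _ _).le, (e3.trans_lt hbcd).le,
        (e4.trans_lt habd).le⟩
    have hc : orient a b c ≤ 0 ∧ orient b c c ≤ 0 ∧ orient c d c ≤ 0 ∧ orient d a c ≤ 0 :=
      ⟨habc.le, (orient_self_right _ _).le, (orient_self_left _ _).le, (e5.trans_lt hacd).le⟩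
    have hd : orient a b d ≤ 0 ∧ orient b c d ≤ 0 ∧ orient c d d ≤ 0 ∧ orient d a d ≤ 0 :=
      ⟨habd.le, hbcd.le, (orient_self_right _ _).le, (orient_self_left _ _).le⟩
    rintro (((h | h) | h) | h)
    · exact ⟨hseg a b ha hb h, fun hz => hz.1.ne (hzero _ _ h)⟩
    · exact ⟨hseg b c hb hc h, fun hz => hz.2.1.ne (hzero _ _ h)⟩
    · exact ⟨hseg c d hc hd h, fun hz => hz.2.2.1.ne (hzero _ _ h)⟩
    · exact ⟨hseg d a hd ha h, fun hz => hz.2.2.2.ne (hzero _ _ h)⟩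

end Quadrilateral

/-! ### Chords and faces for points in convex position. -/

section ConvexPosition

variable {W : Type*} {n : ℕ} {ℓ : W ≃ Set.Icc 1 n} {q : W → Plane}

lemma IsClockwiseConvex.orient_neg (hq : IsClockwiseConvex ℓ q) {x y z : W}
    (hxy : (ℓ x : ℕ) < ℓ y) (hz : (ℓ z : ℕ) < ℓ x ∨ (ℓ y : ℕ) < ℓ z) :
    orient (q x) (q y) (q z) < 0 := by
  rcases hz with hz | hz
  · rw [← orient_rotate]
    exact hq z x y hz hxy
  · exact hq x y z hxy hz

lemma IsClockwiseConvex.orient_pos (hq : IsClockwiseConvex ℓ q) {x y z : W}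
    (hxz : (ℓ x : ℕ) < ℓ z) (hzy : (ℓ z : ℕ) < ℓ y) : 0 < orient (q x) (q y) (q z) := by
  have h : orient (q x) (q z) (q y) < 0 := hq x z y hxz hzy
  have e : orient (q x) (q y) (q z) = -orient (q x) (q z) (q y) := by unfold orient; ring
  linarith

lemma label_injective {x y : W} (h : (ℓ x : ℕ) = ℓ y) : x = y :=
  ℓ.injective (Subtype.ext h)

lemma exists_label (ℓ : W ≃ Set.Icc 1 n) {i : ℕ} (h1 : 1 ≤ i) (hn : i ≤ n) :
    ∃ x, (ℓ x : ℕ) = i :=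
  ⟨ℓ.symm ⟨i, h1, hn⟩, by simp⟩

lemma label_pos (x : W) : 1 ≤ (ℓ x : ℕ) := (ℓ x).2.1

lemma label_le (x : W) : (ℓ x : ℕ) ≤ n := (ℓ x).2.2

lemma IsClockwiseConvex.orient_nonneg (hq : IsClockwiseConvex ℓ q) {x y z : W}
    (hxz : (ℓ x : ℕ) ≤ ℓ z) (hzy : (ℓ z : ℕ) ≤ ℓ y) : 0 ≤ orient (q x) (q y) (q z) := by
  rcases hxz.eq_or_lt with h | h
  · rw [label_injective h, orient_self_left]
  rcases hzy.eq_or_lt with h' | h'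
  · rw [label_injective h', orient_self_right]
  exact (hq.orient_pos h h').le

lemma IsClockwiseConvex.orient_nonpos (hq : IsClockwiseConvex ℓ q) {x y z : W}
    (hxy : (ℓ x : ℕ) < ℓ y) (hz : (ℓ z : ℕ) ≤ ℓ x ∨ (ℓ y : ℕ) ≤ ℓ z) :
    orient (q x) (q y) (q z) ≤ 0 := by
  rcases eq_or_ne (ℓ z : ℕ) (ℓ x) with h | h
  · rw [label_injective h, orient_self_left]
  rcases eq_or_ne (ℓ z : ℕ) (ℓ y) with h' | h'
  · rw [label_injective h', orient_self_right]
  exact (hq.orient_neg hxy (by omega)).le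

lemma IsClockwiseConvex.orient_ne_zero (hq : IsClockwiseConvex ℓ q) {x y z : W}
    (hxy : x ≠ y) (hzx : z ≠ x) (hzy : z ≠ y) : orient (q x) (q y) (q z) ≠ 0 := by
  have hxy' : (ℓ x : ℕ) ≠ ℓ y := fun h => hxy (label_injective h)
  have hzx' : (ℓ z : ℕ) ≠ ℓ x := fun h => hzx (label_injective h)
  have hzy' : (ℓ z : ℕ) ≠ ℓ y := fun h => hzy (label_injective h)
  have main : ∀ {x y : W}, (ℓ x : ℕ) < ℓ y → (ℓ z : ℕ) ≠ ℓ x → (ℓ z : ℕ) ≠ ℓ y →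
      orient (q x) (q y) (q z) ≠ 0 := by
    intro x y h h1 h2
    by_cases hb : (ℓ x : ℕ) < ℓ z ∧ (ℓ z : ℕ) < ℓ y
    · exact (hq.orient_pos hb.1 hb.2).ne'
    · exact (hq.orient_neg h (by omega)).ne
  rcases lt_or_gt_of_ne hxy' with h | h
  · exact main h hzx' hzy'
  · rw [orient_swap]
    exact neg_ne_zero.2 (main h hzy' hzx')

lemma IsClockwiseConvex.injective (hq : IsClockwiseConvex ℓ q) (hn : 3 ≤ n) :
    Function.Injective q := by
  intro x y hxy
  by_contra hne
  obtain ⟨i, hi1, hi3, hix, hiy⟩ : ∃ i, 1 ≤ i ∧ i ≤ 3 ∧ i ≠ (ℓ x : ℕ) ∧ i ≠ (ℓ y : ℕ) := by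
    by_contra! h
    have h1 := h 1
    have h2 := h 2
    have h3 := h 3
    omega
  obtain ⟨z, hz⟩ := exists_label ℓ hi1 (hi3.trans hn)
  refine hq.orient_ne_zero (z := z) hne (by rintro rfl; exact hix hz.symm)
    (by rintro rfl; exact hiy hz.symm) ?_
  rw [hxy]
  unfold orient
  ring

lemma IsClockwiseConvex.orient_side_neg (hq : IsClockwiseConvex ℓ q) (hn : 3 ≤ n) {x y : W}
    (hxy : (ℓ y : ℕ) = ℓ x + 1) {z : Plane} (hz : z ∈ interior (convexHull ℝ (Set.range q))) :
    orient (q x) (q y) z < 0 := by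
  refine orient_neg_of_mem_interior (fun h => ?_) ?_ hz
  · have := hq.injective hn h
    subst this
    omega
  · rintro _ ⟨w, rfl⟩
    exact hq.orient_nonpos (by omega) (by omega)

lemma IsClockwiseConvex.orient_side_pos (hq : IsClockwiseConvex ℓ q) (hn : 3 ≤ n) {x y : W}
    (hx : (ℓ x : ℕ) = 1) (hy : (ℓ y : ℕ) = n) {z : Plane}
    (hz : z ∈ interior (convexHull ℝ (Set.range q))) : 0 < orient (q x) (q y) z := by
  have : orient (q y) (q x) z < 0 := by
    refine orient_neg_of_mem_interior (fun h => ?_) ?_ hz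
    · have := hq.injective hn h
      subst this
      omega
    · rintro _ ⟨w, rfl⟩
      have := hq.orient_nonneg (x := x) (y := y) (z := w) (by rw [hx]; exact label_pos w)
        (by rw [hy]; exact label_le w)
      rw [orient_swap]
      linarith
  rw [orient_swap] at this
  linarith

/-- The hull side leaving `x` and the hull side entering `y` bound the line at its two ends, so
inside the hull it is just the chord. -/
lemma IsClockwiseConvex.mem_segment (hq : IsClockwiseConvex ℓ q) (hn : 3 ≤ n) {x y : W}
    (hxy : (ℓ x : ℕ) < ℓ y) {z : Plane} (hz : z ∈ interior (convexHull ℝ (Set.range q)))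
    (h0 : orient (q x) (q y) z = 0) : z ∈ segment ℝ (q x) (q y) := by
  have hyn := label_le (ℓ := ℓ) y
  have hx1 := label_pos (ℓ := ℓ) x
  obtain ⟨m, hm⟩ := exists_label ℓ (i := ℓ x + 1) (by omega) (by omega)
  obtain ⟨m', hm'⟩ := exists_label ℓ (i := ℓ y - 1) (by omega) (by omega)
  have h1 := hq.orient_side_neg hn hm hz
  have h2 := hq.orient_side_neg hn (x := m') (y := y) (by omega) hz
  have hmy : (ℓ m : ℕ) ≠ ℓ y := by
    intro h
    rw [label_injective h] at h1
    exact h1.ne h0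
  have h3 : orient (q x) (q m) (q y) < 0 := hq.orient_neg (by omega) (by omega)
  have h4 : orient (q m') (q y) (q x) < 0 := hq.orient_neg (by omega) (by omega)
  refine mem_segment_of_orient (m := q m) (m' := q m') h0 h3.ne
    (div_nonneg_of_nonpos h1.le h3.le) ?_ ?_
  · rw [orient_swap]
    exact neg_ne_zero.2 h4.ne
  · rw [orient_swap, orient_swap (q m') (q y) (q x), neg_div_neg_eq]
    exact div_nonneg_of_nonpos h2.le h4.le

/-- A graph without crossing pairs of labels is drawn plane on points in convex position. -/
lemma IsClockwiseConvex.isPlaneDrawing (hq : IsClockwiseConvex ℓ q) (hn : 3 ≤ n)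
    {T : SimpleGraph W}
    (hcross : ∀ x y x' y', T.Adj x y → T.Adj x' y' →
      ¬ ((ℓ x : ℕ) < ℓ x' ∧ (ℓ x' : ℕ) < ℓ y ∧ (ℓ y : ℕ) < ℓ y')) : IsPlaneDrawing q T := by
  have hve : ∀ x y z : W, T.Adj x y → q z ∈ segment ℝ (q x) (q y) → z = x ∨ z = y := by
    rintro x y z hxy ⟨s, t, -, -, hst, hz⟩
    by_contra! hne
    refine hq.orient_ne_zero hxy.ne hne.1 hne.2 ?_
    rw [← hz, orient_combo _ _ _ _ hst, orient_self_left, orient_self_right]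
    ring
  refine ⟨hq.injective hn, hve, ?_⟩
  intro x y x' y' hxy hxy' hne
  wlog hlt : (ℓ x : ℕ) < ℓ y generalizing x y
  · have hlt' : (ℓ y : ℕ) < ℓ x := by
      have : (ℓ x : ℕ) ≠ ℓ y := fun h => hxy.ne (label_injective h)
      omega
    have := this y x hxy.symm (by rwa [Sym2.eq_swap]) hlt'
    rwa [segment_symm, Set.pair_comm y x] at this
  wlog hlt' : (ℓ x' : ℕ) < ℓ y' generalizing x' y'
  · have hlt'' : (ℓ y' : ℕ) < ℓ x' := by
      have : (ℓ x' : ℕ) ≠ ℓ y' := fun h => hxy'.ne (label_injective h)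
      omega
    have := this y' x' hxy'.symm (by rwa [Sym2.eq_swap (a := y')]) hlt''
    rwa [segment_symm ℝ (q y'), Set.pair_comm y' x'] at this
  rintro z ⟨hz, s, t, hs, ht, hst, rfl⟩
  by_cases hs0 : s = 0
  · obtain rfl : t = 1 := by linarith
    rw [hs0, zero_smul, one_smul, zero_add] at hz ⊢
    exact ⟨y', ⟨hve x y y' hxy hz, by simp⟩, rfl⟩
  by_cases ht0 : t = 0
  · obtain rfl : s = 1 := by linarith
    rw [ht0, zero_smul, one_smul, add_zero] at hz ⊢
    exact ⟨x', ⟨hve x y x' hxy hz, by simp⟩, rfl⟩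
  exfalso
  have hs' : 0 < s := lt_of_le_of_ne hs (Ne.symm hs0)
  have ht' : 0 < t := lt_of_le_of_ne ht (Ne.symm ht0)
  have hzero : s * orient (q x) (q y) (q x') + t * orient (q x) (q y) (q y') = 0 := by
    rw [← orient_combo _ _ _ _ hst]
    obtain ⟨s', t', -, -, hst', hz'⟩ := hz
    rw [← hz', orient_combo _ _ _ _ hst', orient_self_left, orient_self_right]
    ring
  -- As the chords do not cross, `x'` and `y'` lie in one closed half-plane of the line `xy`. A
  -- strictly inner point of `x'y'` on that line puts both ends on it.
  have hboth : orient (q x) (q y) (q x') = 0 ∧ orient (q x) (q y) (q y') = 0 := by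
    have c1 := hcross x y x' y' hxy hxy'
    have c2 := hcross x' y' x y hxy' hxy
    by_cases hin : (ℓ x : ℕ) ≤ ℓ x' ∧ (ℓ y' : ℕ) ≤ ℓ y
    · have h1 := hq.orient_nonneg (x := x) (y := y) (z := x') (by omega) (by omega)
      have h2 := hq.orient_nonneg (x := x) (y := y) (z := y') (by omega) (by omega)
      constructor <;> nlinarith [mul_nonneg hs'.le h1, mul_nonneg ht'.le h2]
    · have h1 := hq.orient_nonpos (x := x) (y := y) (z := x') hlt (by omega)
      have h2 := hq.orient_nonpos (x := x) (y := y) (z := y') hlt (by omega)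
      constructor <;> nlinarith [mul_nonneg hs'.le (neg_nonneg.2 h1),
        mul_nonneg ht'.le (neg_nonneg.2 h2)]
  have hx' : x' = x ∨ x' = y := by
    by_contra! h
    exact hq.orient_ne_zero hxy.ne h.1 h.2 hboth.1
  have hy' : y' = x ∨ y' = y := by
    by_contra! h
    exact hq.orient_ne_zero hxy.ne h.1 h.2 hboth.2
  rcases hx' with rfl | rfl <;> rcases hy' with rfl | rfl
  · exact hxy'.ne rfl
  · exact hne rfl
  · exact hne Sym2.eq_swap
  · exact hxy'.ne rfl

lemma disjoint_openQuad_drawing (hq : IsClockwiseConvex ℓ q) {T : SimpleGraph W}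
    (hcross : ∀ x y x' y', T.Adj x y → T.Adj x' y' →
      ¬ ((ℓ x : ℕ) < ℓ x' ∧ (ℓ x' : ℕ) < ℓ y ∧ (ℓ y : ℕ) < ℓ y'))
    (hodd : ∀ x y, T.Adj x y → Odd ((ℓ x : ℕ) + ℓ y)) {a b c d : W} (hab : T.Adj a b)
    (hbc : T.Adj b c) (hcd : T.Adj c d) (had : T.Adj a d) (lab : (ℓ a : ℕ) < ℓ b)
    (lbc : (ℓ b : ℕ) < ℓ c) (lcd : (ℓ c : ℕ) < ℓ d) :
    Disjoint (openQuad (q a) (q b) (q c) (q d)) (drawing q T) := by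
  have hside : ∀ x y : W, (x = y ∨ T.Adj x y) → (ℓ x : ℕ) ≤ ℓ y →
      Disjoint (openQuad (q a) (q b) (q c) (q d)) (segment ℝ (q x) (q y)) := by
    intro x y hxy hle
    have hcomb : ∀ p r : Plane, 0 ≤ orient p r (q x) → 0 ≤ orient p r (q y) →
        ∀ z ∈ segment ℝ (q x) (q y), 0 ≤ orient p r z := by
      rintro p r h1 h2 z ⟨s, t, hs, ht, hst, rfl⟩
      rw [orient_combo _ _ _ _ hst]
      positivity
    -- An edge crossing no side of the quadrilateral has both ends on one of the four closed arcs
    -- cut off by its corners, unless it is a diagonal `ac` or `bd`; those join labels of equal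
    -- parity.
    have hpos : ((ℓ a : ℕ) ≤ ℓ x ∧ (ℓ y : ℕ) ≤ ℓ b) ∨ ((ℓ b : ℕ) ≤ ℓ x ∧ (ℓ y : ℕ) ≤ ℓ c) ∨
        ((ℓ c : ℕ) ≤ ℓ x ∧ (ℓ y : ℕ) ≤ ℓ d) ∨
        (((ℓ x : ℕ) ≤ ℓ a ∨ (ℓ d : ℕ) ≤ ℓ x) ∧ ((ℓ y : ℕ) ≤ ℓ a ∨ (ℓ d : ℕ) ≤ ℓ y)) := by
      rcases hxy with rfl | hxy
      · omega
      · have c1 := hcross a b x y hab hxy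
        have c2 := hcross x y a b hxy hab
        have c3 := hcross b c x y hbc hxy
        have c4 := hcross x y b c hxy hbc
        have c5 := hcross c d x y hcd hxy
        have c6 := hcross x y c d hxy hcd
        have c7 := hcross a d x y had hxy
        have c8 := hcross x y a d hxy had
        have o1 := Nat.odd_iff.1 (hodd a b hab)
        have o2 := Nat.odd_iff.1 (hodd b c hbc)
        have o3 := Nat.odd_iff.1 (hodd c d hcd)
        have o4 := Nat.odd_iff.1 (hodd x y hxy)
        omega
    rw [Set.disjoint_left]
    rintro z ⟨h1, h2, h3, h4⟩ hz
    rcases hpos with h | h | h | h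
    · exact absurd h1 (not_lt.2 (hcomb _ _ (hq.orient_nonneg (by omega) (by omega))
        (hq.orient_nonneg (by omega) (by omega)) z hz))
    · exact absurd h2 (not_lt.2 (hcomb _ _ (hq.orient_nonneg (by omega) (by omega))
        (hq.orient_nonneg (by omega) (by omega)) z hz))
    · exact absurd h3 (not_lt.2 (hcomb _ _ (hq.orient_nonneg (by omega) (by omega))
        (hq.orient_nonneg (by omega) (by omega)) z hz))
    · refine absurd h4 (not_lt.2 (hcomb _ _ ?_ ?_ z hz))
      · rw [orient_swap, neg_nonneg]
        exact hq.orient_nonpos (by omega) (by omega)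
      · rw [orient_swap, neg_nonneg]
        exact hq.orient_nonpos (by omega) (by omega)
  rw [Set.disjoint_left]
  rintro z hz (⟨x, rfl⟩ | ⟨x, y, hxy, hz'⟩)
  · exact Set.disjoint_left.1 (hside x x (Or.inl rfl) le_rfl) hz (by simp)
  · rcases le_total (ℓ x : ℕ) (ℓ y) with h | h
    · exact Set.disjoint_left.1 (hside x y (Or.inr hxy) h) hz hz'
    · rw [segment_symm] at hz'
      exact Set.disjoint_left.1 (hside y x (Or.inr hxy.symm) h) hz hz'

/-- A crossing-free graph on points in convex position, all of whose edges join labels of opposite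
parity, is a `4`-angulation if every point of the interior of the hull off the lines of its edges
lies in one of its `4`-cycles. -/
lemma isAngulation_four (hq : IsClockwiseConvex ℓ q) (hn : 3 ≤ n) {T : SimpleGraph W}
    (hcross : ∀ x y x' y', T.Adj x y → T.Adj x' y' →
      ¬ ((ℓ x : ℕ) < ℓ x' ∧ (ℓ x' : ℕ) < ℓ y ∧ (ℓ y : ℕ) < ℓ y'))
    (hodd : ∀ x y, T.Adj x y → Odd ((ℓ x : ℕ) + ℓ y))
    (hquad : ∀ z ∈ interior (convexHull ℝ (Set.range q)),
      (∀ x y, T.Adj x y → orient (q x) (q y) z ≠ 0) →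
      ∃ a b c d, (ℓ a : ℕ) < ℓ b ∧ (ℓ b : ℕ) < ℓ c ∧ (ℓ c : ℕ) < ℓ d ∧ T.Adj a b ∧ T.Adj b c ∧
        T.Adj c d ∧ T.Adj a d ∧ z ∈ openQuad (q a) (q b) (q c) (q d)) :
    IsAngulation 4 q T := by
  refine ⟨hq.isPlaneDrawing hn hcross, ?_⟩
  rintro C ⟨z, ⟨hzI, hzD⟩, rfl⟩
  -- Inside the hull the line of an edge coincides with the edge, so a point off the drawing is off
  -- all these lines.
  obtain ⟨a, b, c, d, lab, lbc, lcd, hab, hbc, hcd, had, hz⟩ := hquad z hzI (by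
    intro x y hxy h0
    refine hzD (Or.inr ⟨x, y, hxy, ?_⟩)
    rcases lt_trichotomy (ℓ x : ℕ) (ℓ y) with h | h | h
    · exact hq.mem_segment hn h hzI h0
    · exact absurd (label_injective h) hxy.ne
    · rw [segment_symm]
      refine hq.mem_segment hn h hzI ?_
      rw [orient_swap, h0, neg_zero])
  have habc : orient (q a) (q b) (q c) < 0 := hq a b c lab lbc
  have habd : orient (q a) (q b) (q d) < 0 := hq a b d lab (lbc.trans lcd)
  have hacd : orient (q a) (q c) (q d) < 0 := hq a c d (lab.trans lbc) lcd
  have hbcd : orient (q b) (q c) (q d) < 0 := hq b c d lbc lcd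
  have hfr := frontier_openQuad habc habd hacd hbcd ⟨z, hz⟩
  have hdisj := disjoint_openQuad_drawing hq hcross hodd hab hbc hcd had lab lbc lcd
  have hOI : openQuad (q a) (q b) (q c) (q d) ⊆ interior (convexHull ℝ (Set.range q)) :=
    interior_maximal (openQuad_subset_convexHull ⟨a, rfl⟩ ⟨b, rfl⟩ ⟨c, rfl⟩ ⟨d, rfl⟩ habc hacd)
      isOpen_openQuad
  have hfrD : frontier (openQuad (q a) (q b) (q c) (q d)) ⊆ drawing q T := by
    rw [hfr]
    rintro w (((h | h) | h) | h)
    · exact Or.inr ⟨a, b, hab, h⟩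
    · exact Or.inr ⟨b, c, hbc, h⟩
    · exact Or.inr ⟨c, d, hcd, h⟩
    · exact Or.inr ⟨d, a, had.symm, h⟩
  have hC : connectedComponentIn (interior (convexHull ℝ (Set.range q)) \ drawing q T) z =
      openQuad (q a) (q b) (q c) (q d) := by
    apply subset_antisymm
    -- The component misses the boundary of the quadrilateral, which is drawn, so the quadrilateral
    -- and the exterior of its closure would separate it.
    · refine isPreconnected_connectedComponentIn.subset_left_of_subset_union isOpen_openQuad
        (v := (closure (openQuad (q a) (q b) (q c) (q d)))ᶜ) isClosed_closure.isOpen_compl ?_ ?_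
        ⟨z, mem_connectedComponentIn ⟨hzI, hzD⟩, hz⟩
      · exact Set.disjoint_compl_right_iff_subset.2 subset_closure
      · intro w hw
        by_cases hwO : w ∈ openQuad (q a) (q b) (q c) (q d)
        · exact Or.inl hwO
        · refine Or.inr fun hcl => ?_
          refine (connectedComponentIn_subset _ _ hw).2 (hfrD ?_)
          rw [isOpen_openQuad.frontier_eq]
          exact ⟨hcl, hwO⟩
    · exact convex_openQuad.isPreconnected.subset_connectedComponentIn hz fun w hw =>
        ⟨hOI hw, Set.disjoint_left.1 hdisj hw⟩
  have nab := hab.ne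
  have nbc := hbc.ne
  have ncd := hcd.ne
  have nad := had.ne
  have nac : a ≠ c := by rintro rfl; omega
  have nbd : b ≠ d := by rintro rfl; omega
  refine ⟨a, .cons hab (.cons hbc (.cons hcd (.cons had.symm .nil))), ?_, rfl, ?_⟩
  · rw [SimpleGraph.Walk.cons_isCycle_iff]
    simp [SimpleGraph.Walk.isPath_def, nab, nbc, ncd, nad, nac, nbd, nab.symm, nad.symm,
      nac.symm]
  · rw [hC, hfr]
    ext w
    simp only [SimpleGraph.Walk.edges_cons, SimpleGraph.Walk.edges_nil, List.mem_cons,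
      List.not_mem_nil, or_false, Set.mem_union, Set.mem_ofPred_eq]
    constructor
    · rintro (((h | h) | h) | h)
      · exact ⟨a, b, by simp, h⟩
      · exact ⟨b, c, by simp, h⟩
      · exact ⟨c, d, by simp, h⟩
      · exact ⟨d, a, by simp, h⟩
    · have key : ∀ x y x' y' : W, s(x, y) = s(x', y') → w ∈ segment ℝ (q x) (q y) →
          w ∈ segment ℝ (q x') (q y') := by
        intro x y x' y' h hw
        rcases Sym2.eq_iff.1 h with ⟨rfl, rfl⟩ | ⟨rfl, rfl⟩
        · exact hw
        · rwa [segment_symm]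
      rintro ⟨x, y, h | h | h | h, hw⟩
      · exact .inl (.inl (.inl (key _ _ _ _ h hw)))
      · exact .inl (.inl (.inr (key _ _ _ _ h hw)))
      · exact .inl (.inr (key _ _ _ _ h hw))
      · exact .inr (key _ _ _ _ h hw)

end ConvexPosition

/-! ### The two dissections into quadrilaterals. -/

section Dissections

variable {W : Type*} {n : ℕ} {ℓ : W ≃ Set.Icc 1 n} {q : W → Plane}

/-- The convex `n`-gon with all diagonals from vertex `1` to the vertices with even labels. -/
def fan (ℓ : W ≃ Set.Icc 1 n) : SimpleGraph W :=
  SimpleGraph.fromRel fun x y =>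
    (ℓ y : ℕ) = ℓ x + 1 ∨ ((ℓ x : ℕ) = 1 ∧ Even (ℓ y : ℕ))

lemma fan_adj_of_lt {x y : W} (h : (fan ℓ).Adj x y) (hlt : (ℓ x : ℕ) < ℓ y) :
    (ℓ y : ℕ) = ℓ x + 1 ∨ ((ℓ x : ℕ) = 1 ∧ Even (ℓ y : ℕ)) := by
  have h1 := label_pos (ℓ := ℓ) x
  rcases h.2 with h | h | h
  · exact h
  · omega
  · omega

lemma fan_adj {x y : W} (hlt : (ℓ x : ℕ) < ℓ y)
    (h : (ℓ y : ℕ) = ℓ x + 1 ∨ ((ℓ x : ℕ) = 1 ∧ Even (ℓ y : ℕ))) : (fan ℓ).Adj x y :=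
  ⟨by rintro rfl; omega, Or.inl h⟩

/-- The faces are `v₁ v_{2i} v_{2i+1} v_{2i+2}`. Evenness of `n` makes the hull side `v₁ v_n` one of
the spokes. -/
lemma isAngulation_fan (hq : IsClockwiseConvex ℓ q) (hn : 4 ≤ n) (hev : Even n) :
    IsAngulation 4 q (fan ℓ) := by
  refine isAngulation_four hq (by omega) ?_ ?_ ?_
  · rintro x y x' y' h h' ⟨h1, h2, h3⟩
    have := fan_adj_of_lt h (by omega)
    have := fan_adj_of_lt h' (by omega)
    omega
  · intro x y h
    rcases lt_trichotomy (ℓ x : ℕ) (ℓ y) with hlt | heq | hlt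
    · have := fan_adj_of_lt h hlt
      grind
    · exact absurd (label_injective heq) h.ne
    · have := fan_adj_of_lt h.symm hlt
      grind
  · intro z hz hne
    obtain ⟨r, hr⟩ := exists_label ℓ (i := 1) le_rfl (by omega)
    obtain ⟨k, hk⟩ := hev
    -- The sign of `z` relative to the spokes is negative at `v₂` and positive at `v_n`, so it
    -- changes between two successive spokes; these bound the face of `z`.
    have hstep : ∃ i, 1 ≤ i ∧ i < k ∧ (∃ w, (ℓ w : ℕ) = 2 * i ∧ orient (q r) (q w) z < 0) ∧
        ¬ ∃ w, (ℓ w : ℕ) = 2 * (i + 1) ∧ orient (q r) (q w) z < 0 := by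
      by_contra! hall
      have hP : ∀ i, 1 ≤ i → i ≤ k → ∃ w, (ℓ w : ℕ) = 2 * i ∧ orient (q r) (q w) z < 0 := by
        intro i hi
        induction i, hi using Nat.le_induction with
        | base =>
          intro _
          obtain ⟨w, hw⟩ := exists_label ℓ (i := 2) (by omega) (by omega)
          exact ⟨w, by omega, hq.orient_side_neg (by omega) (by omega) hz⟩
        | succ i hi ih =>
          intro hik
          exact hall i hi (by omega) (ih (by omega))
      obtain ⟨w, hw, hlt⟩ := hP k (by omega) le_rfl
      exact absurd hlt (not_lt.2 (hq.orient_side_pos (by omega) hr (by omega) hz).le)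
    obtain ⟨i, hi1, hik, ⟨b, hb, hbz⟩, hnot⟩ := hstep
    obtain ⟨c, hc⟩ := exists_label ℓ (i := 2 * i + 1) (by omega) (by omega)
    obtain ⟨d, hd⟩ := exists_label ℓ (i := 2 * i + 2) (by omega) (by omega)
    have hrd : (fan ℓ).Adj r d := fan_adj (by omega) (Or.inr ⟨hr, by rw [hd]; grind⟩)
    refine ⟨r, b, c, d, by omega, by omega, by omega,
      fan_adj (by omega) (Or.inr ⟨hr, by rw [hb]; grind⟩), fan_adj (by omega) (Or.inl (by omega)),
      fan_adj (by omega) (Or.inl (by omega)), hrd, hbz,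
      hq.orient_side_neg (by omega) (by omega) hz, hq.orient_side_neg (by omega) (by omega) hz, ?_⟩
    have h1 := hne r d hrd
    have h2 : ¬ orient (q r) (q d) z < 0 := fun h => hnot ⟨d, by omega, h⟩
    rw [orient_swap, neg_lt_zero]
    exact lt_of_le_of_ne (not_lt.1 h2) h1.symm

/-- The convex octagon with the diagonals `16` and `25`. -/
def octagonDissection (ℓ : W ≃ Set.Icc 1 n) : SimpleGraph W :=
  SimpleGraph.fromRel fun x y =>
    (ℓ y : ℕ) = ℓ x + 1 ∨ ((ℓ x : ℕ) = 1 ∧ (ℓ y : ℕ) = 8) ∨ ((ℓ x : ℕ) = 1 ∧ (ℓ y : ℕ) = 6) ∨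
      ((ℓ x : ℕ) = 2 ∧ (ℓ y : ℕ) = 5)

lemma octagonDissection_adj_of_lt {x y : W} (h : (octagonDissection ℓ).Adj x y)
    (hlt : (ℓ x : ℕ) < ℓ y) :
    (ℓ y : ℕ) = ℓ x + 1 ∨ ((ℓ x : ℕ) = 1 ∧ (ℓ y : ℕ) = 8) ∨ ((ℓ x : ℕ) = 1 ∧ (ℓ y : ℕ) = 6) ∨
      ((ℓ x : ℕ) = 2 ∧ (ℓ y : ℕ) = 5) := by
  rcases h.2 with h | h
  · exact h
  · omega

lemma octagonDissection_adj {x y : W} (hlt : (ℓ x : ℕ) < ℓ y)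
    (h : (ℓ y : ℕ) = ℓ x + 1 ∨ ((ℓ x : ℕ) = 1 ∧ (ℓ y : ℕ) = 8) ∨
      ((ℓ x : ℕ) = 1 ∧ (ℓ y : ℕ) = 6) ∨ ((ℓ x : ℕ) = 2 ∧ (ℓ y : ℕ) = 5)) :
    (octagonDissection ℓ).Adj x y :=
  ⟨by rintro rfl; omega, Or.inl h⟩

lemma isAngulation_octagonDissection (hq : IsClockwiseConvex ℓ q) (hn : n = 8) :
    IsAngulation 4 q (octagonDissection ℓ) := by
  refine isAngulation_four hq (by omega) ?_ ?_ ?_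
  · rintro x y x' y' h h' ⟨h1, h2, h3⟩
    have := octagonDissection_adj_of_lt h (by omega)
    have := octagonDissection_adj_of_lt h' (by omega)
    have := label_le (ℓ := ℓ) y'
    omega
  · intro x y h
    rw [Nat.odd_iff]
    rcases lt_trichotomy (ℓ x : ℕ) (ℓ y) with hlt | heq | hlt
    · have := octagonDissection_adj_of_lt h hlt
      omega
    · exact absurd (label_injective heq) h.ne
    · have := octagonDissection_adj_of_lt h.symm hlt
      omega
  · intro z hz hne
    obtain ⟨v₁, h₁⟩ := exists_label ℓ (i := 1) (by omega) (by omega)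
    obtain ⟨v₂, h₂⟩ := exists_label ℓ (i := 2) (by omega) (by omega)
    obtain ⟨v₃, h₃⟩ := exists_label ℓ (i := 3) (by omega) (by omega)
    obtain ⟨v₄, h₄⟩ := exists_label ℓ (i := 4) (by omega) (by omega)
    obtain ⟨v₅, h₅⟩ := exists_label ℓ (i := 5) (by omega) (by omega)
    obtain ⟨v₆, h₆⟩ := exists_label ℓ (i := 6) (by omega) (by omega)
    obtain ⟨v₇, h₇⟩ := exists_label ℓ (i := 7) (by omega) (by omega)
    obtain ⟨v₈, h₈⟩ := exists_label ℓ (i := 8) (by omega) (by omega)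
    have hside : ∀ {x y : W}, (ℓ y : ℕ) = ℓ x + 1 → orient (q x) (q y) z < 0 := fun h =>
      hq.orient_side_neg (by omega) h hz
    have h16 : (octagonDissection ℓ).Adj v₁ v₆ := octagonDissection_adj (by omega) (by omega)
    have h25 : (octagonDissection ℓ).Adj v₂ v₅ := octagonDissection_adj (by omega) (by omega)
    rcases lt_or_gt_of_ne (hne v₁ v₆ h16) with g | g
    · refine ⟨v₁, v₆, v₇, v₈, by omega, by omega, by omega, h16,
        octagonDissection_adj (by omega) (by omega), octagonDissection_adj (by omega) (by omega),
        octagonDissection_adj (by omega) (by omega), g, hside (by omega), hside (by omega), ?_⟩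
      rw [orient_swap, neg_lt_zero]
      exact hq.orient_side_pos (by omega) h₁ (by omega) hz
    rcases lt_or_gt_of_ne (hne v₂ v₅ h25) with g' | g'
    · refine ⟨v₁, v₂, v₅, v₆, by omega, by omega, by omega,
        octagonDissection_adj (by omega) (by omega), h25,
        octagonDissection_adj (by omega) (by omega), h16, hside (by omega), g', hside (by omega),
        ?_⟩
      rwa [orient_swap, neg_lt_zero]
    · refine ⟨v₂, v₃, v₄, v₅, by omega, by omega, by omega,
        octagonDissection_adj (by omega) (by omega), octagonDissection_adj (by omega) (by omega),
        octagonDissection_adj (by omega) (by omega), h25, hside (by omega), hside (by omega),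
        hside (by omega), ?_⟩
      rwa [orient_swap, neg_lt_zero]

end Dissections

/-! ### From tours to labelings. -/

section Labelings

variable {V : Type*} [Finite V] {Γ : SimpleGraph V} {n : ℕ}

/-- After an even rotation the tour starts at `u`. Position `i` receives label `i + 1`, so the even
positions, which are those of `A`, become odd labels. -/
lemma exists_labeling_of_tour (hn : Even n) (hV : Nat.card V = n) {A : Set V} {c : ℕ → V}
    (hc : IsAvoidingTour Γ A n c) {u : V} (hu : u ∈ A) :
    ∃ ℓ : V ≃ Set.Icc 1 n, (ℓ u : ℕ) = 1 ∧ (∀ x ∈ A, Odd (ℓ x : ℕ)) ∧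
      ∀ x y, Γ.Adj x y → |((ℓ x : ℕ) : ℤ) - ((ℓ y : ℕ) : ℤ)| ∉ ({1, (n : ℤ) - 1} : Set ℤ) := by
  have hbij : ∀ c : ℕ → V, IsAvoidingTour Γ A n c →
      Function.Bijective fun i : Fin n => c i := fun c hc =>
    (Nat.bijective_iff_injective_and_card _).2
      ⟨fun i j hij => Fin.ext (hc.injOn i i.2 j j.2 hij), by simp [hV]⟩
  obtain ⟨⟨s, hs⟩, hsu⟩ := (hbij c hc).2 u
  beta_reduce at hsu
  have hse : Even s := (hc.mem_iff s hs).1 (hsu ▸ hu)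
  obtain ⟨c', hc', h0⟩ : ∃ c', IsAvoidingTour Γ A n c' ∧ c' 0 = u :=
    ⟨_, hc.rotate hn hse hs, by simp [hs, hsu]⟩
  let e : Fin n ≃ V := Equiv.ofBijective _ (hbij c' hc')
  let g : Fin n ≃ Set.Icc 1 n :=
    { toFun := fun i => ⟨i + 1, by simp, i.2⟩
      invFun := fun j => ⟨j - 1, by have := j.2.1; have := j.2.2; omega⟩
      left_inv := fun i => by simp
      right_inv := fun j => Subtype.ext (by have := j.2.1; simp; omega) }
  have hℓ : ∀ i (hi : i < n), (((e.symm.trans g) (c' i) : Set.Icc 1 n) : ℕ) = i + 1 := by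
    intro i hi
    have : e.symm (c' i) = ⟨i, hi⟩ := (Equiv.symm_apply_eq e).2 rfl
    simp [this, g]
  have hsurj : ∀ x, ∃ i < n, c' i = x := fun x => by
    obtain ⟨i, hi⟩ := (hbij c' hc').2 x
    exact ⟨i, i.2, hi⟩
  refine ⟨e.symm.trans g, ?_, ?_, ?_⟩
  · rw [← h0, hℓ 0 (by omega)]
  · intro x hx
    obtain ⟨i, hi, rfl⟩ := hsurj x
    rw [hℓ i hi]
    exact ((hc'.mem_iff i hi).1 hx).add_one
  · intro x y hxy
    obtain ⟨i, hi, rfl⟩ := hsurj x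
    obtain ⟨j, hj, rfl⟩ := hsurj y
    rw [hℓ i hi, hℓ j hj]
    have hi1 : i + 1 ≠ j := by
      rintro rfl
      exact hc'.not_adj i hj hxy
    have hj1 : j + 1 ≠ i := by
      rintro rfl
      exact hc'.not_adj j hi hxy.symm
    have hw1 : ¬ (i = n - 1 ∧ j = 0) := by
      rintro ⟨rfl, rfl⟩
      exact hc'.not_adj_wrap hxy
    have hw2 : ¬ (j = n - 1 ∧ i = 0) := by
      rintro ⟨rfl, rfl⟩
      exact hc'.not_adj_wrap hxy.symm
    simp only [Set.mem_insert_iff, Set.mem_singleton_iff, not_or]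
    push_cast
    constructor
    · intro h
      rcases abs_eq (by norm_num) |>.1 h with h | h <;> omega
    · intro h
      rcases abs_eq (by omega) |>.1 h with h | h <;> omega

end Labelings

/-! ### Degrees in the underlying simple graph of a cubic multigraph. -/

section Multigraph

variable {α β : Type*} {G : Graph α β}

/-- Counting neighbours becomes counting the image of the incident edges under `φ`, which fails to
be injective exactly at a `2`-cycle. Edges not at `x` get the default value `x`. -/
lemma exists_otherEnd (G : Graph α β) (x : V(G)) :
    ∃ φ : β → V(G), ∀ e y, G.IsLink e x y → (φ e : α) = y := by
  classical
  refine ⟨fun e => if h : G.Inc e x then ⟨h.other, h.isLink_other.right_mem⟩ else x, ?_⟩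
  intro e y hy
  have h : G.Inc e x := hy.inc_left
  simp only [dif_pos h]
  exact h.isLink_other.right_unique hy

lemma finite_incidenceSet (hreg : IsThreeRegular G) (x : V(G)) : (G.incidenceSet x).Finite :=
  Set.finite_of_ncard_ne_zero (by rw [hreg x x.2]; norm_num)

lemma neighborSet_eq_image [G.Loopless] {x : V(G)} {φ : β → V(G)}
    (hφ : ∀ e y, G.IsLink e x y → (φ e : α) = y) :
    G.toSimpleGraph.neighborSet x = φ '' G.incidenceSet x := by
  ext y
  rw [SimpleGraph.mem_neighborSet, toSimpleGraph_adj_iff]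
  constructor
  · rintro ⟨e, he⟩
    exact ⟨e, he.inc_left, Subtype.ext (hφ e y he)⟩
  · rintro ⟨e, ⟨z, hz⟩, rfl⟩
    exact ⟨e, by rwa [hφ e z hz]⟩

lemma ncard_neighborSet_le_three [G.Loopless] (hreg : IsThreeRegular G) (x : V(G)) :
    (G.toSimpleGraph.neighborSet x).ncard ≤ 3 := by
  obtain ⟨φ, hφ⟩ := exists_otherEnd G x
  rw [neighborSet_eq_image hφ, ← hreg x x.2]
  exact Set.ncard_image_le (finite_incidenceSet hreg x)

lemma ncard_neighborSet_eq_three [G.Loopless] (hreg : IsThreeRegular G) {x : V(G)}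
    (hx : ∀ y, ¬ IsTwoCycle G x y) : (G.toSimpleGraph.neighborSet x).ncard = 3 := by
  obtain ⟨φ, hφ⟩ := exists_otherEnd G x
  rw [neighborSet_eq_image hφ, ← hreg x x.2]
  refine Set.InjOn.ncard_image ?_
  rintro e ⟨y, hy⟩ f ⟨z, hz⟩ hef
  by_contra hne
  have hyz : y = z := by rw [← hφ e y hy, ← hφ f z hz, hef]
  exact hx y ⟨e, f, hne, hy, hyz ▸ hz⟩

lemma ncard_neighborSet_le_two [G.Loopless] (hreg : IsThreeRegular G) {x : V(G)} {y : α}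
    (hxy : IsTwoCycle G x y) : (G.toSimpleGraph.neighborSet x).ncard ≤ 2 := by
  obtain ⟨φ, hφ⟩ := exists_otherEnd G x
  obtain ⟨e, f, hef, he, hf⟩ := hxy
  have hsub : G.toSimpleGraph.neighborSet x ⊆ φ '' (G.incidenceSet x \ {f}) := by
    rw [neighborSet_eq_image hφ]
    rintro _ ⟨g, hg, rfl⟩
    by_cases hgf : g = f
    · refine ⟨e, ⟨he.inc_left, hef⟩, Subtype.ext ?_⟩
      rw [hgf, hφ e y he, hφ f y hf]
    · exact ⟨g, ⟨hg, hgf⟩, rfl⟩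
  have hfin := (finite_incidenceSet hreg x).subset (Set.sdiff_subset (t := {f}))
  have h1 := Set.ncard_le_ncard hsub (hfin.image φ)
  have h2 := Set.ncard_image_le (f := φ) hfin
  have h3 := Set.ncard_sdiff_singleton_of_mem (s := G.incidenceSet x) hf.inc_left
  rw [hreg x x.2] at h3
  omega

lemma IsTwoCycle.symm {u v : α} (h : IsTwoCycle G u v) : IsTwoCycle G v u := by
  obtain ⟨e, f, hef, he, hf⟩ := h
  exact ⟨e, f, hef, he.symm, hf.symm⟩

/-- In a connected cubic multigraph with more than two vertices no three edges are parallel. -/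
lemma two_le_ncard_neighborSet [G.Loopless] [Finite V(G)] (hconn : G.toSimpleGraph.Connected)
    (hV : 2 < Nat.card V(G)) (hreg : IsThreeRegular G) {x y : V(G)} (hxy : IsTwoCycle G x y) :
    2 ≤ (G.toSimpleGraph.neighborSet x).ncard := by
  by_contra! hlt
  have hadj : G.toSimpleGraph.Adj x y := by
    rw [toSimpleGraph_adj_iff]
    obtain ⟨e, -, -, he, -⟩ := hxy
    exact ⟨e, he⟩
  have hx : ∀ z, G.toSimpleGraph.Adj x z → z = y := by
    intro z hz
    by_contra hne
    have hsub : ({z, y} : Set V(G)) ⊆ G.toSimpleGraph.neighborSet x := by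
      rintro w (rfl | rfl) <;> assumption
    have := Set.ncard_le_ncard hsub
    rw [Set.ncard_pair hne] at this
    omega
  -- If `y` is the only neighbour of `x`, the three edges at `x` are the three at `y`, and `{x, y}`
  -- is a whole component.
  have hsub : G.incidenceSet x ⊆ G.incidenceSet y := by
    rintro e ⟨z, hz⟩
    have := hx ⟨z, hz.right_mem⟩ (by rw [toSimpleGraph_adj_iff]; exact ⟨e, hz⟩)
    rw [← this]
    exact hz.inc_right
  have heq := Set.eq_of_subset_of_ncard_le hsub (by rw [hreg x x.2, hreg y y.2])
    (finite_incidenceSet hreg y)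
  have hy : ∀ z, G.toSimpleGraph.Adj y z → z = x := by
    intro z hz
    rw [toSimpleGraph_adj_iff] at hz
    obtain ⟨e, he⟩ := hz
    have hinc : e ∈ G.incidenceSet x := heq ▸ he.inc_left
    obtain ⟨w, hw⟩ := hinc
    rcases hw.left_eq_or_eq he with h | h
    · exact absurd (Subtype.ext h) hadj.ne
    · exact (Subtype.ext h).symm
  obtain ⟨a, b, ha, hb, hab⟩ := exists_adj_mem_notMem hconn (A := {x, y}) ⟨x, by simp⟩ (by
    intro h
    have := Set.ncard_pair hadj.ne
    rw [h, Set.ncard_univ] at this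
    omega)
  rcases ha with rfl | rfl
  · exact hb (by simp [hx b hab])
  · exact hb (by simp [hy b hab])

lemma not_isTwoCycle_of_simple [hG : G.Simple] (x y : α) : ¬ IsTwoCycle G x y := by
  rintro ⟨e, f, hef, he, hf⟩
  exact hef (he.eq hf)

lemma not_isTwoCycle_of_ne (htwo : AtMostOneTwoCycle G) {u v x : α} (huv : IsTwoCycle G u v)
    (hxu : x ≠ u) (hxv : x ≠ v) (y : α) : ¬ IsTwoCycle G x y := by
  intro h
  rcases Sym2.eq_iff.1 (htwo u v x y huv h) with ⟨h1, -⟩ | ⟨-, h1⟩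
  · exact hxu h1.symm
  · exact hxv h1.symm

/-- The handshake lemma for the underlying simple graph; `S` stands for the ends of the `2`-cycle,
whose degree drops to `2`. -/
lemma even_card_of_degrees {V : Type*} [Finite V] (Γ : SimpleGraph V) (S : Set V)
    (hS : Even S.ncard) (h3 : ∀ x ∉ S, (Γ.neighborSet x).ncard = 3)
    (h2 : ∀ x ∈ S, (Γ.neighborSet x).ncard = 2) : Even (Nat.card V) := by
  classical
  have := Fintype.ofFinite V
  have hdeg : ∀ x, Γ.degree x = (Γ.neighborSet x).ncard := fun x => by
    rw [← SimpleGraph.card_neighborFinset_eq_degree, ← Set.ncard_coe_finset,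
      SimpleGraph.coe_neighborFinset]
  have hodd := Γ.even_card_odd_degree_vertices
  have hset : ({v | Odd (Γ.degree v)} : Finset V) = Sᶜ.toFinset := by
    ext x
    by_cases hx : x ∈ S
    · simp [hx, hdeg, h2 x hx]
    · simp [hx, hdeg, h3 x hx, Nat.odd_iff]
  rw [hset, ← Set.ncard_eq_toFinset_card'] at hodd
  rw [← Set.ncard_add_ncard_compl S]
  exact hS.add hodd

lemma even_card [G.Loopless] [Finite V(G)] (hconn : G.toSimpleGraph.Connected)
    (hV : 2 < Nat.card V(G)) (hreg : IsThreeRegular G) (htwo : AtMostOneTwoCycle G) :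
    Even (Nat.card V(G)) := by
  by_cases hex : ∃ u v, IsTwoCycle G u v
  · obtain ⟨u, v, huv⟩ := hex
    obtain ⟨hu, hv, hne⟩ : u ∈ V(G) ∧ v ∈ V(G) ∧ u ≠ v := by
      obtain ⟨e, -, -, he, -⟩ := huv
      exact ⟨he.left_mem, he.right_mem, he.ne⟩
    refine even_card_of_degrees G.toSimpleGraph {⟨u, hu⟩, ⟨v, hv⟩} ?_ ?_ ?_
    · rw [Set.ncard_pair (by simpa using hne)]
      exact even_two
    · intro x hx
      simp only [Set.mem_insert_iff, Set.mem_singleton_iff, not_or] at hx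
      exact ncard_neighborSet_eq_three hreg
        (not_isTwoCycle_of_ne htwo huv (fun h => hx.1 (Subtype.ext h))
          (fun h => hx.2 (Subtype.ext h)))
    · rintro x (rfl | rfl)
      · exact le_antisymm (ncard_neighborSet_le_two hreg huv)
          (two_le_ncard_neighborSet hconn hV hreg (y := ⟨v, hv⟩) huv)
      · exact le_antisymm (ncard_neighborSet_le_two hreg huv.symm)
          (two_le_ncard_neighborSet hconn hV hreg (y := ⟨u, hu⟩) huv.symm)
  · push Not at hex
    exact even_card_of_degrees G.toSimpleGraph ∅ (by simp)
      (fun x _ => ncard_neighborSet_eq_three hreg (hex x)) (by simp)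

lemma exists_isOddLabeling [G.Simple] [Finite V(G)] {n : ℕ} (hV : Nat.card V(G) = n)
    (hn : 8 ≤ n) (hev : Even n) (hconn : G.toSimpleGraph.Connected) (hreg : IsThreeRegular G)
    (hcube : ¬ IsCube G) : ∃ ℓ : V(G) ≃ Set.Icc 1 n, IsOddLabeling G ℓ := by
  obtain ⟨k, rfl⟩ := hev
  rw [← two_mul] at *
  have hdeg : ∀ x, (G.toSimpleGraph.neighborSet x).ncard = 3 := fun x =>
    ncard_neighborSet_eq_three hreg (not_isTwoCycle_of_simple x.1)
  obtain ⟨u, A, c, hu, hN, hc⟩ : ∃ u A c, u ∈ A ∧ G.toSimpleGraph.neighborSet u ⊆ A ∧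
      IsAvoidingTour G.toSimpleGraph A (2 * k) c := by
    obtain hk | rfl : 5 ≤ k ∨ k = 4 := by omega
    · obtain ⟨u⟩ := hconn.nonempty
      exact ⟨u, exists_tour_of_five_le hconn hk hV hdeg u⟩
    · exact exists_tour_of_order_eight hconn hV hdeg fun h => hcube ⟨inferInstance, h⟩
  obtain ⟨ℓ, hℓu, hℓA, hℓ⟩ := exists_labeling_of_tour (even_two_mul k) hV hc hu
  obtain ⟨x, y, z, hxy, hxz, hyz, hNu⟩ := Set.ncard_eq_three.1 (hdeg u)
  have hadj : ∀ w ∈ G.toSimpleGraph.neighborSet u,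
      G.Adj u w ∧ Odd (ℓ w : ℕ) ∧ (ℓ w : ℕ) ≠ 1 := by
    intro w hw
    refine ⟨(toSimpleGraph_adj_iff u w).1 hw, hℓA w (hN hw), fun h => ?_⟩
    have hwu : G.toSimpleGraph.Adj u w := hw
    exact hwu.ne (label_injective (hℓu.trans h.symm))
  have hx := hadj x (by simp [hNu])
  have hy := hadj y (by simp [hNu])
  have hz := hadj z (by simp [hNu])
  exact ⟨ℓ, ⟨u, x, y, z, hℓu, hx.1, hy.1, hz.1, hx.2.1, hy.2.1, hz.2.1, hx.2.2, hy.2.2, hz.2.2,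
    fun h => hxy (label_injective h), fun h => hxz (label_injective h),
    fun h => hyz (label_injective h)⟩,
    fun x y hxy => hℓ x y ((toSimpleGraph_adj_iff x y).2 hxy)⟩

lemma exists_isTwoCycleLabeling [G.Loopless] [Finite V(G)] {n : ℕ} (hV : Nat.card V(G) = n)
    (hn : 8 ≤ n) (hev : Even n) (hconn : G.toSimpleGraph.Connected) (hreg : IsThreeRegular G)
    (htwo : AtMostOneTwoCycle G) {u v : V(G)} (huv : IsTwoCycle G u v) :
    ∃ ℓ : V(G) ≃ Set.Icc 1 n, IsTwoCycleLabeling G ℓ u v := by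
  obtain ⟨k, rfl⟩ := hev
  rw [← two_mul] at *
  have hadj : G.toSimpleGraph.Adj u v := by
    rw [toSimpleGraph_adj_iff]
    obtain ⟨e, -, -, he, -⟩ := huv
    exact ⟨e, he⟩
  obtain ⟨w, huw, hwv⟩ := Set.exists_ne_of_one_lt_ncard
    (two_le_ncard_neighborSet hconn (by omega) hreg huv) v
  have huw : G.toSimpleGraph.Adj u w := huw
  obtain ⟨A, c, hu, hv, hw, hc⟩ := exists_tour_of_degree_two hconn (k := k) (by omega) hV
    (ncard_neighborSet_le_three hreg) hadj huw hwv.symm (ncard_neighborSet_le_two hreg huv)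
    (ncard_neighborSet_le_two hreg huv.symm)
    (ncard_neighborSet_eq_three hreg (not_isTwoCycle_of_ne htwo huv
      (fun h => huw.ne (Subtype.ext h.symm)) (fun h => hwv (Subtype.ext h))))
  obtain ⟨ℓ, hℓu, hℓA, hℓ⟩ := exists_labeling_of_tour (even_two_mul k) hV hc hu
  exact ⟨ℓ, hℓu, ⟨w, (toSimpleGraph_adj_iff u w).1 huw, hℓA v hv, hℓA w hw,
    fun h => hadj.ne (label_injective (hℓu.trans h.symm)),
    fun h => huw.ne (label_injective (hℓu.trans h.symm)),
    fun h => hwv (label_injective h.symm)⟩,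
    fun x y hxy => hℓ x y ((toSimpleGraph_adj_iff x y).2 hxy)⟩

end Multigraph

/-! ### Labelings of the cube. -/

section CubeLabelings

variable {α β : Type*} {G : Graph α β}

/-- A vertex `q` not adjacent to `r` is the antipode of `r` or at distance two from it; in the
latter case it misses only one neighbour of `r`, namely its own antipode. -/
lemma cube_hammingDist_eq_three : ∀ r p q : Fin 3 → Bool, cube.Adj r p → ¬ cube.Adj r q →
    r ≠ q → ¬ cube.Adj p q → hammingDist r q = 3 ∨ hammingDist p q = 3 := by
  decide

lemma cube_antipode_unique : ∀ p q q' : Fin 3 → Bool, hammingDist p q = 3 →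
    hammingDist p q' = 3 → q = q' := by
  decide

lemma card_eq_eight_of_isCube (h : IsCube G) : Nat.card V(G) = 8 := by
  obtain ⟨-, ⟨φ⟩⟩ := h
  rw [Nat.card_congr φ.toEquiv]
  simp

lemma not_isOddLabeling_of_isCube [Finite V(G)] (h : IsCube G) (hreg : IsThreeRegular G)
    (ℓ : V(G) ≃ Set.Icc 1 8) : ¬ IsOddLabeling G ℓ := by
  obtain ⟨hsimple, ⟨φ⟩⟩ := h
  rintro ⟨⟨r, x, y, z, hr, hx, hy, hz, ox, oy, oz, x1, y1, z1, hxy, hxz, hyz⟩, hcons⟩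
  have hadj : ∀ a b : V(G), cube.Adj (φ a) (φ b) ↔ G.Adj a b := fun a b => by
    rw [φ.map_adj_iff, toSimpleGraph_adj_iff]
  have hiff : ∀ w : V(G), G.Adj r w → w = x ∨ w = y ∨ w = z := by
    intro w hw
    refine eq_or_eq_or_eq_of_ncard_le_three (ncard_neighborSet_le_three hreg r)
      ((toSimpleGraph_adj_iff r x).2 hx) ((toSimpleGraph_adj_iff r y).2 hy)
      ((toSimpleGraph_adj_iff r z).2 hz) ?_ ?_ ?_ ((toSimpleGraph_adj_iff r w).2 hw)
    · rintro rfl; exact hxy rfl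
    · rintro rfl; exact hxz rfl
    · rintro rfl; exact hyz rfl
  -- The labels `3, 5, 7` are the only odd ones left, so they are exactly the neighbours of `r`.
  have hoddr : ∀ w : V(G), Odd (ℓ w : ℕ) → (ℓ w : ℕ) ≠ 1 → G.Adj r w := by
    intro w hw hw1
    have := label_le (ℓ := ℓ) w
    have := label_le (ℓ := ℓ) x
    have := label_le (ℓ := ℓ) y
    have := label_le (ℓ := ℓ) z
    rw [Nat.odd_iff] at *
    obtain h | h | h : (ℓ w : ℕ) = ℓ x ∨ (ℓ w : ℕ) = ℓ y ∨ (ℓ w : ℕ) = ℓ z := by omega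
    · rwa [label_injective h]
    · rwa [label_injective h]
    · rwa [label_injective h]
  have hevr : ∀ w : V(G), Even (ℓ w : ℕ) → ¬ G.Adj r w := by
    intro w hw hrw
    rw [← Nat.not_odd_iff_even] at hw
    rcases hiff w hrw with rfl | rfl | rfl <;> contradiction
  obtain ⟨v₂, h₂⟩ := exists_label ℓ (i := 2) (by omega) (by omega)
  obtain ⟨v₃, h₃⟩ := exists_label ℓ (i := 3) (by omega) (by omega)
  obtain ⟨v₄, h₄⟩ := exists_label ℓ (i := 4) (by omega) (by omega)
  obtain ⟨v₅, h₅⟩ := exists_label ℓ (i := 5) (by omega) (by omega)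
  obtain ⟨v₆, h₆⟩ := exists_label ℓ (i := 6) (by omega) (by omega)
  obtain ⟨v₇, h₇⟩ := exists_label ℓ (i := 7) (by omega) (by omega)
  obtain ⟨v₈, h₈⟩ := exists_label ℓ (i := 8) (by omega) (by omega)
  have hne : ∀ {a b : V(G)}, (ℓ a : ℕ) ≠ ℓ b → φ a ≠ φ b := fun h h' =>
    h (by rw [φ.injective h'])
  -- The two vertices next to `p` in the labeling cannot both be the antipode of `p`, so one is the
  -- antipode of `r`.
  have hanti : ∀ p a b : V(G), Odd (ℓ p : ℕ) → (ℓ p : ℕ) ≠ 1 → (ℓ a : ℕ) + 1 = ℓ p →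
      (ℓ p : ℕ) + 1 = ℓ b →
      hammingDist (φ r) (φ a) = 3 ∨ hammingDist (φ r) (φ b) = 3 := by
    intro p a b hp hp1 ha hb
    have key : ∀ w : V(G), ((ℓ w : ℕ) + 1 = ℓ p ∨ (ℓ p : ℕ) + 1 = ℓ w) →
        hammingDist (φ r) (φ w) = 3 ∨ hammingDist (φ p) (φ w) = 3 := by
      intro w hw
      have hpw : ¬ G.Adj p w := by
        intro h
        refine hcons p w h (Or.inl ?_)
        rcases hw with hw | hw
        · rw [← hw]; push_cast; simp
        · rw [← hw]; push_cast; simp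
      have hwe : Even (ℓ w : ℕ) := by grind
      refine cube_hammingDist_eq_three _ _ _ ((hadj r p).2 (hoddr p hp hp1))
        (fun h => hevr w hwe ((hadj r w).1 h)) (hne (by grind))
        (fun h => hpw ((hadj p w).1 h))
    rcases key a (Or.inl ha) with h | h
    · exact Or.inl h
    rcases key b (Or.inr hb) with h' | h'
    · exact Or.inr h'
    exact absurd (cube_antipode_unique _ _ _ h h') (hne (by omega))
  have e1 := hanti v₃ v₂ v₄ (by rw [h₃]; decide) (by omega) (by omega) (by omega)
  have e2 := hanti v₅ v₄ v₆ (by rw [h₅]; decide) (by omega) (by omega) (by omega)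
  have e3 := hanti v₇ v₆ v₈ (by rw [h₇]; decide) (by omega) (by omega) (by omega)
  have huniq : ∀ {a b : V(G)}, (ℓ a : ℕ) ≠ ℓ b → hammingDist (φ r) (φ a) = 3 →
      hammingDist (φ r) (φ b) = 3 → False := fun hab h h' =>
    hne hab (cube_antipode_unique _ _ _ h h')
  rcases e1 with e1 | e1 <;> rcases e2 with e2 | e2
  · exact huniq (by omega) e1 e2
  · exact huniq (by omega) e1 e2
  · rcases e3 with e3 | e3
    · exact huniq (by omega) e2 e3
    · exact huniq (by omega) e2 e3
  · exact huniq (by omega) e1 e2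

/-- The labels of the cube vertices. -/
def cubeLabel (s : Fin 3 → Bool) : ℕ := ![1, 3, 4, 6, 7, 5, 2, 8] (cubeCode s)

lemma cubeLabel_mem : ∀ s, cubeLabel s ∈ Set.Icc 1 8 := by
  have : ∀ s, 1 ≤ cubeLabel s ∧ cubeLabel s ≤ 8 := by decide
  exact this

lemma cubeLabel_injective : Function.Injective cubeLabel := by
  intro s t
  revert s t
  decide

lemma cube_adj_iff_cubeLabel (s t : Fin 3 → Bool) :
    cube.Adj s t ↔ s(cubeLabel s, cubeLabel t) ∈ labeledCubeEdges := by
  have : ∀ s t : Fin 3 → Bool, cube.Adj s t ↔ s(cubeLabel s, cubeLabel t) ∈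
      ({s(1, 3), s(1, 4), s(1, 7), s(2, 4), s(2, 7), s(2, 8),
        s(3, 5), s(3, 6), s(4, 6), s(5, 7), s(5, 8), s(6, 8)} : Finset (Sym2 ℕ)) := by
    decide
  rw [this s t, ← Finset.mem_coe]
  simp only [Finset.coe_insert, Finset.coe_singleton]
  rfl

lemma exists_isCubeLabeling (h : IsCube G) : ∃ ℓ : V(G) ≃ Set.Icc 1 8, IsCubeLabeling G ℓ := by
  obtain ⟨hsimple, ⟨φ⟩⟩ := h
  have hbij : Function.Bijective fun s => (⟨cubeLabel s, cubeLabel_mem s⟩ : Set.Icc 1 8) :=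
    (Nat.bijective_iff_injective_and_card _).2
      ⟨fun s t hst => cubeLabel_injective (congrArg Subtype.val hst),
        by rw [Nat.card_eq_fintype_card, Nat.card_eq_fintype_card]; simp⟩
  refine ⟨φ.toEquiv.trans (Equiv.ofBijective _ hbij), fun x y => ?_⟩
  rw [← toSimpleGraph_adj_iff, ← φ.map_adj_iff]
  exact cube_adj_iff_cubeLabel _ _

end CubeLabelings

/-! ### The dissections avoid the edges of `G`. -/

section Angulations

variable {α β : Type*} {G : Graph α β} {n : ℕ} {ℓ : V(G) ≃ Set.Icc 1 n}

lemma yieldsFourAngulation_of_odd [G.Loopless] (hn : 4 ≤ n) (hev : Even n)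
    (hcons : NoConsecutive G ℓ) {r : V(G)} (hr : (ℓ r : ℕ) = 1)
    (hodd : ∀ y : V(G), G.Adj r y → Odd (ℓ y : ℕ)) : YieldsFourAngulation G ℓ := by
  intro q hq
  refine ⟨fan ℓ, fun x y hxy => ⟨hxy.ne, fun hG => ?_⟩, isAngulation_fan hq hn hev⟩
  have main : ∀ x y : V(G), (ℓ x : ℕ) < ℓ y → (fan ℓ).Adj x y → G.Adj x y → False := by
    intro x y hlt hxy hG
    rcases fan_adj_of_lt hxy hlt with h | ⟨h1, h2⟩
    · refine hcons x y hG (Or.inl ?_)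
      rw [h]
      push_cast
      simp
    · obtain rfl : x = r := label_injective (h1.trans hr.symm)
      exact (Nat.not_odd_iff_even.2 h2) (hodd y hG)
  have hG' := (toSimpleGraph_adj_iff x y).1 hG
  rcases lt_trichotomy (ℓ x : ℕ) (ℓ y) with h | h | h
  · exact main x y h hxy hG'
  · exact hxy.ne (label_injective h)
  · exact main y x h hxy.symm hG'.symm

lemma mem_labeledCubeEdges {i j : ℕ} (h : s(i, j) ∈ labeledCubeEdges) (_hij : i < j) :
    j ≤ 8 ∧ j ≠ i + 1 ∧ ¬ (i = 1 ∧ j = 8) ∧ ¬ (i = 1 ∧ j = 6) ∧ ¬ (i = 2 ∧ j = 5) := by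
  simp only [labeledCubeEdges, Set.mem_insert_iff, Set.mem_singleton_iff, Sym2.eq_iff] at h
  omega

lemma yieldsFourAngulation_of_isCubeLabeling [G.Loopless] (hn : 8 ≤ n)
    (hconn : G.toSimpleGraph.Connected) (hℓ : IsCubeLabeling G ℓ) : YieldsFourAngulation G ℓ := by
  have main : ∀ x y : V(G), (ℓ x : ℕ) < ℓ y → G.Adj x y → _ := fun x y h hG =>
    mem_labeledCubeEdges ((hℓ x y).1 hG) h
  -- The prescribed edges use only labels up to `8`, so a vertex labeled `9` would be isolated in a
  -- connected graph.
  have hn8 : n = 8 := by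
    by_contra hne
    obtain ⟨x, hx⟩ := exists_label ℓ (i := 9) (by omega) (by omega)
    obtain ⟨y, hy⟩ := exists_label ℓ (i := 1) (by omega) (by omega)
    have : Nontrivial V(G) := ⟨x, y, by rintro rfl; omega⟩
    obtain ⟨z, hz⟩ := hconn.preconnected.exists_adj_of_nontrivial x
    rw [toSimpleGraph_adj_iff] at hz
    rcases lt_trichotomy (ℓ x : ℕ) (ℓ z) with h | h | h
    · have := main x z h hz
      omega
    · exact hz.ne (congrArg Subtype.val (label_injective h))
    · have := main z x h hz.symm
      omega
  intro q hq
  refine ⟨octagonDissection ℓ, fun x y hxy => ⟨hxy.ne, fun hG => ?_⟩,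
    isAngulation_octagonDissection hq hn8⟩
  have hG' := (toSimpleGraph_adj_iff x y).1 hG
  rcases lt_trichotomy (ℓ x : ℕ) (ℓ y) with h | h | h
  · have := octagonDissection_adj_of_lt hxy h
    have := main x y h hG'
    omega
  · exact hxy.ne (label_injective h)
  · have := octagonDissection_adj_of_lt hxy.symm h
    have := main y x h hG'.symm
    omega

end Angulations

end CubicLabeling

theorem mainTheorem9 {α β : Type*} (G : Graph α β) (n : ℕ) (hloop : G.Loopless)
    (hcard : V(G).ncard = n) (hn : 8 ≤ n)
    (hconn : G.toSimpleGraph.Connected)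
    (hreg : CubicLabeling.IsThreeRegular G)
    (htwo : CubicLabeling.AtMostOneTwoCycle G) :
    (G.Simple → ¬ CubicLabeling.IsCube G →
      ∃ ℓ : V(G) ≃ Set.Icc 1 n, CubicLabeling.IsOddLabeling G ℓ) ∧
    (CubicLabeling.IsCube G →
      (¬ ∃ ℓ : V(G) ≃ Set.Icc 1 n, CubicLabeling.IsOddLabeling G ℓ) ∧
      ∃ ℓ : V(G) ≃ Set.Icc 1 n, CubicLabeling.IsCubeLabeling G ℓ) ∧
    (∀ u v : V(G), CubicLabeling.IsTwoCycle G u v →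
      ∃ ℓ : V(G) ≃ Set.Icc 1 n, CubicLabeling.IsTwoCycleLabeling G ℓ u v) ∧
    (∀ ℓ : V(G) ≃ Set.Icc 1 n,
      (CubicLabeling.IsOddLabeling G ℓ ∨ CubicLabeling.IsCubeLabeling G ℓ ∨
        ∃ u v : V(G), CubicLabeling.IsTwoCycle G u v ∧
          CubicLabeling.IsTwoCycleLabeling G ℓ u v) →
      CubicLabeling.YieldsFourAngulation G ℓ) := by
  open CubicLabeling in
  have hfin : Finite V(G) := (Set.finite_of_ncard_ne_zero (by omega)).to_subtype
  have hV : Nat.card V(G) = n := by rw [Nat.card_coe_set_eq, hcard]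
  have hev : Even n := hV ▸ even_card hconn (by omega) hreg htwo
  refine ⟨fun hsimple hcube => exists_isOddLabeling hV hn hev hconn hreg hcube, fun hcube => ?_,
    fun u v huv => exists_isTwoCycleLabeling hV hn hev hconn hreg htwo huv, ?_⟩
  · obtain rfl : 8 = n := (card_eq_eight_of_isCube hcube).symm.trans hV
    exact ⟨fun ⟨ℓ, hℓ⟩ => not_isOddLabeling_of_isCube hcube hreg ℓ hℓ,
      exists_isCubeLabeling hcube⟩
  · rintro ℓ (⟨⟨r, x, y, z, hr, hx, hy, hz, ox, oy, oz, -, -, -, hxy, hxz, hyz⟩, hcons⟩ | hℓ |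
      ⟨u, v, huv, hu, ⟨w, huw, ov, ow, -, -, hvw⟩, hcons⟩)
    · refine yieldsFourAngulation_of_odd (by omega) hev hcons hr fun t ht => ?_
      rcases eq_or_eq_or_eq_of_ncard_le_three (ncard_neighborSet_le_three hreg r)
        ((toSimpleGraph_adj_iff r x).2 hx) ((toSimpleGraph_adj_iff r y).2 hy)
        ((toSimpleGraph_adj_iff r z).2 hz) (by rintro rfl; exact hxy rfl)
        (by rintro rfl; exact hxz rfl) (by rintro rfl; exact hyz rfl)
        ((toSimpleGraph_adj_iff r t).2 ht) with rfl | rfl | rfl <;> assumption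
    · exact yieldsFourAngulation_of_isCubeLabeling hn hconn hℓ
    · refine yieldsFourAngulation_of_odd (by omega) hev hcons hu fun t ht => ?_
      by_contra hodd
      -- An end of the `2`-cycle has at most two neighbours, so `v` and `w`, both with odd labels,
      -- are all of them.
      have hsub : ({v, w, t} : Set V(G)) ⊆ G.toSimpleGraph.neighborSet u := by
        rintro s (rfl | rfl | rfl)
        · obtain ⟨e, -, -, he, -⟩ := huv
          exact (toSimpleGraph_adj_iff u s).2 ⟨e, he⟩
        · exact (toSimpleGraph_adj_iff u s).2 huw
        · exact (toSimpleGraph_adj_iff u s).2 ht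
      have h1 := Set.ncard_le_ncard hsub
      rw [ncard_triple (by rintro rfl; exact hvw rfl) (by rintro rfl; exact hodd ov)
        (by rintro rfl; exact hodd ow)] at h1
      have h2 := ncard_neighborSet_le_two hreg huv
      omega
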